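/- Let $n\in\{2,3\}$, let $\Omega\subset\mathbb R^n$ be a bounded domain with smooth boundary and outward unit normal $\nu$, and let $\varepsilon>0$, $\Omega_\varepsilon=\{x\in\Omega:\operatorname{dist}(x,\partial\Omega)\le\varepsilon\}$. Sobolev spaces on $\Omega_\varepsilon$ are understood on its interior. Let $0<\sigma\in C^1(\overline\Omega)$, $0<h\in C(\partial\Omega)$, and let $g\in C(\partial\Omega)$ satisfy $g\le 0$, $g\not\equiv 0$. Let $u\in C^{2,\alpha_0}(\overline\Omega)$, $0<\alpha_0<1$, solve $$-\nabla\cdot(\sigma\nabla u)=0\ \text{ in }\Omega,\qquad \sigma\,\partial_\nu u+hu=g\ \text{ on }\partial\Omega,$$ and let $U=u$ be the exact data. Let $0\le\rho\in C_0^\infty(\mathbb R)$ with $\operatorname{supp}\rho\subset(0,1)$ and $\int_{\mathbb R^n}\rho(|x|)\,dx=1$, and put $\rho_\alpha(t)=\alpha^{-n}\rho(t/\alpha)$ for $\alpha>0$. Fix a bounded set $V\supseteq \operatorname{int}\Omega_\varepsilon$ and a linear extension operator $w\mapsto\tilde w$ from functions on $\Omega_\varepsilon$ to functions on $\mathbb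 R^n$ vanishing a.e. outside $V$, with $\tilde w=w$ a.e. in $\operatorname{int}\Omega_\varepsilon$, which is bounded from $H^1(\Omega_\varepsilon)$ to $H^1(\mathbb R^n)$ and maps $H^2(\Omega_\varepsilon)$ into $H^2(\mathbb R^n)$. Define $$R_\alpha[w](x)=\int_{\mathbb R^n}\rho_\alpha(|x-y|)\,\tilde w(y)\,dy .$$ For noisy data $U^\delta\in H^1(\Omega_\varepsilon)$ with $\|U^\delta-U\|_{H^1(\Omega_\varepsilon)}\le\delta$ let $$h^{\alpha,\delta}(x)=\frac{g(x)-\sigma(x)\,\partial_\nu R_\alpha[U^\delta](x)}{U(x)},\qquad x\in\partial\Omega .$$ Put $\lambda_0=\min\{\alpha_0,1/2\}$ and let $0<c_1\le c_2$. Then there is a constant $C>0$, which does not depend on $\delta$, $\alpha$ or $U^\delta$, such that for every $\delta>0$, every $\alpha=\alpha(\delta)$ with $$c_1\,\delta^{1/(n/2+\lambda_0)}\le\alpha(\delta)\le c_2\,\delta^{1/(n/2+\lambda_0)},$$ and all noisy data $U^\delta$ as above, $$\|h^{\alpha(\delta),\delta}-h\|_{L^2(\partial\Omega)}\le C\,\delta^{\lambda_0/(n/2+\lambda_0)}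 .$$ -/

import Mathlib

open MeasureTheory Set
open scoped ContDiff ENNReal

noncomputable section

namespace RobinInverse

/-- The `i`-th standard unit vector of `ℝⁿ`. -/
abbrev stdVec {n : ℕ} (i : Fin n) : EuclideanSpace ℝ (Fin n) := EuclideanSpace.single i 1

/-! ### Bounded smooth domains, outward normal, surface measure -/

/-- `φ` is a smooth defining function of `Ω` on the open neighbourhood `V` of `x`:
`Ω` is `{φ < 0}` in `V` and `∇φ` does not vanish there (so `∂Ω` is `{φ = 0}` in `V`). -/
structure IsLocalDefiningFunction {n : ℕ} (Ω : Set (EuclideanSpace ℝ (Fin n)))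
    (x : EuclideanSpace ℝ (Fin n)) (V : Set (EuclideanSpace ℝ (Fin n)))
    (φ : EuclideanSpace ℝ (Fin n) → ℝ) : Prop where
  isOpen : IsOpen V
  mem : x ∈ V
  smooth : ContDiffOn ℝ ∞ φ V
  gradient_ne_zero : ∀ y ∈ V, gradient φ y ≠ 0
  inter_eq : Ω ∩ V = {y ∈ V | φ y < 0}

/-- A bounded domain (nonempty open connected set) with smooth boundary. -/
structure IsBoundedSmoothDomain {n : ℕ} (Ω : Set (EuclideanSpace ℝ (Fin n))) : Prop where
  isOpen : IsOpen Ω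
  isConnected : IsConnected Ω
  isBounded : Bornology.IsBounded Ω
  smooth_boundary : ∀ x ∈ frontier Ω, ∃ V φ, IsLocalDefiningFunction Ω x V φ

/-- `ν` is the outward unit normal of `Ω` at the boundary point `x`: `ν = ∇φ(x) / |∇φ(x)|` for a
local defining function `φ` (the value does not depend on `φ`). -/
def IsOutwardUnitNormal {n : ℕ} (Ω : Set (EuclideanSpace ℝ (Fin n)))
    (x ν : EuclideanSpace ℝ (Fin n)) : Prop :=
  ∃ V φ, IsLocalDefiningFunction Ω x V φ ∧ ν = ‖gradient φ x‖⁻¹ • gradient φ x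

/-- The surface measure on `∂Ω`: the `(n-1)`-dimensional Hausdorff measure (in the Euclidean
normalization) restricted to `∂Ω`. -/
def surfaceMeasure {n : ℕ} (Ω : Set (EuclideanSpace ℝ (Fin n))) :
    Measure (EuclideanSpace ℝ (Fin n)) :=
  (Measure.euclideanHausdorffMeasure (n - 1)).restrict (frontier Ω)

/-- The layer `Ω_ε = {x ∈ Ω : dist(x, ∂Ω) ≤ ε}`. -/
def boundaryLayer {n : ℕ} (Ω : Set (EuclideanSpace ℝ (Fin n))) (ε : ℝ) :
    Set (EuclideanSpace ℝ (Fin n)) :=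
  {x ∈ Ω | Metric.infDist x (frontier Ω) ≤ ε}

/-! ### Sobolev spaces on an open set -/

/-- `g` is the weak partial derivative `∂ᵢ f` in the open set `W`. -/
structure HasWeakPartial {n : ℕ} (W : Set (EuclideanSpace ℝ (Fin n))) (i : Fin n)
    (f g : EuclideanSpace ℝ (Fin n) → ℝ) : Prop where
  locInt_fun : LocallyIntegrableOn f W
  locInt_deriv : LocallyIntegrableOn g W
  integral_eq : ∀ φ : EuclideanSpace ℝ (Fin n) → ℝ, ContDiff ℝ ∞ φ → HasCompactSupport φ →
    tsupport φ ⊆ W → ∫ x in W, f x * fderiv ℝ φ x (stdVec i) = - ∫ x in W, g x * φ x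

open Classical in
/-- The weak partial derivative `∂ᵢ f` in `W` (unique up to null sets; `0` if there is none). -/
def weakPartial {n : ℕ} (W : Set (EuclideanSpace ℝ (Fin n))) (i : Fin n)
    (f : EuclideanSpace ℝ (Fin n) → ℝ) : EuclideanSpace ℝ (Fin n) → ℝ :=
  if h : ∃ g, HasWeakPartial W i f g then h.choose else 0

/-- `f ∈ H¹(W)`. -/
def MemH1 {n : ℕ} (W : Set (EuclideanSpace ℝ (Fin n))) (f : EuclideanSpace ℝ (Fin n) → ℝ) : Prop :=
  MemLp f 2 (volume.restrict W) ∧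
    ∀ i, (∃ g, HasWeakPartial W i f g) ∧ MemLp (weakPartial W i f) 2 (volume.restrict W)

/-- `f ∈ H²(W)`. -/
def MemH2 {n : ℕ} (W : Set (EuclideanSpace ℝ (Fin n))) (f : EuclideanSpace ℝ (Fin n) → ℝ) : Prop :=
  MemH1 W f ∧ ∀ i, MemH1 W (weakPartial W i f)

/-- The norm `‖f‖_{H¹(W)} = (‖f‖²_{L²(W)} + ∑ᵢ ‖∂ᵢ f‖²_{L²(W)})^{1/2}` of `f ∈ H¹(W)`. -/
def h1Norm {n : ℕ} (W : Set (EuclideanSpace ℝ (Fin n))) (f : EuclideanSpace ℝ (Fin n) → ℝ) :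
    ℝ≥0∞ :=
  (eLpNorm f 2 (volume.restrict W) ^ 2 +
    ∑ i, eLpNorm (weakPartial W i f) 2 (volume.restrict W) ^ 2) ^ (1 / 2 : ℝ)

/-- A Sobolev extension operator `f ↦ f̃` from the open set `W` to `ℝⁿ`, with supports in the bounded
set `V`: it is linear and bounded from `H¹(W)` to `H¹(ℝⁿ)`, and maps `H²(W)` into `H²(ℝⁿ)`.
(Its values outside `H¹(W)` are irrelevant.) -/
structure SobolevExtension {n : ℕ} (W V : Set (EuclideanSpace ℝ (Fin n))) where
  toFun : (EuclideanSpace ℝ (Fin n) → ℝ) → EuclideanSpace ℝ (Fin n) → ℝ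
  subset : W ⊆ V
  isBounded : Bornology.IsBounded V
  map_add : ∀ f g, MemH1 W f → MemH1 W g →
    toFun (fun x => f x + g x) =ᵐ[volume] fun x => toFun f x + toFun g x
  map_smul : ∀ (c : ℝ) f, MemH1 W f →
    toFun (fun x => c * f x) =ᵐ[volume] fun x => c * toFun f x
  extends_fun : ∀ f, MemH1 W f → toFun f =ᵐ[volume.restrict W] f
  support : ∀ f, MemH1 W f → ∀ᵐ x, x ∉ V → toFun f x = 0
  bound_h1 : ∃ C : ℝ, ∀ f, MemH1 W f →
    MemH1 univ (toFun f) ∧ h1Norm univ (toFun f) ≤ ENNReal.ofReal C * h1Norm W f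
  map_h2 : ∀ f, MemH2 W f → MemH2 univ (toFun f)

/-! ### The Robin problem -/

/-- `u ∈ C^{2,α}(Ω̄)`. -/
def MemC2Holder {n : ℕ} (Ω : Set (EuclideanSpace ℝ (Fin n))) (α : ℝ)
    (u : EuclideanSpace ℝ (Fin n) → ℝ) : Prop :=
  ContDiffOn ℝ 2 u (closure Ω) ∧
    ∃ K : ℝ, ∀ x ∈ closure Ω, ∀ y ∈ closure Ω,
      ‖iteratedFDerivWithin ℝ 2 u (closure Ω) x - iteratedFDerivWithin ℝ 2 u (closure Ω) y‖
        ≤ K * ‖x - y‖ ^ α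

/-- `u` solves `-∇·(σ∇u) = 0` in `Ω` and `σ ∂_ν u + h u = g` on `∂Ω` in the classical sense. -/
structure IsRobinSolution {n : ℕ} (Ω : Set (EuclideanSpace ℝ (Fin n)))
    (ν : EuclideanSpace ℝ (Fin n) → EuclideanSpace ℝ (Fin n))
    (σ h g u : EuclideanSpace ℝ (Fin n) → ℝ) : Prop where
  pde : ∀ x ∈ Ω,
    -∑ i, fderiv ℝ (fun y => σ y * fderiv ℝ u y (stdVec i)) x (stdVec i) = 0
  boundary : ∀ x ∈ frontier Ω,
    σ x * fderivWithin ℝ u (closure Ω) x (ν x) + h x * u x = g x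

/-! ### Mollification and the regularizing solution -/

/-- An admissible profile: `0 ≤ ρ ∈ C_0^∞(ℝ)`, `supp ρ ⊂ (0,1)`, normalized so that `x ↦ ρ(|x|)` has
unit mass on `ℝⁿ`; in polar coordinates `∫₀^∞ ρ(t) t dt = 1/(2π)` for `n = 2` and
`∫₀^∞ ρ(t) t² dt = 1/(4π)` for `n = 3`. -/
structure IsMollifierProfile (n : ℕ) (ρ : ℝ → ℝ) : Prop where
  smooth : ContDiff ℝ ∞ ρ
  nonneg : ∀ t, 0 ≤ ρ t
  support : tsupport ρ ⊆ Ioo 0 1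
  mass : ∫ x : EuclideanSpace ℝ (Fin n), ρ ‖x‖ = 1

/-- The kernel `ρ_α(t) = α⁻ⁿ ρ(t/α)`. -/
def scaledKernel (n : ℕ) (ρ : ℝ → ℝ) (α t : ℝ) : ℝ := 1 / α ^ n * ρ (t / α)

/-- `R_α[w](x) = ∫ ρ_α(|x-y|) w̃(y) dy`, where `w̃` is the extension of `w` from `W` to `ℝⁿ`. -/
def mollify {n : ℕ} {W V : Set (EuclideanSpace ℝ (Fin n))} (ρ : ℝ → ℝ) (E : SobolevExtension W V)
    (α : ℝ) (w : EuclideanSpace ℝ (Fin n) → ℝ) (x : EuclideanSpace ℝ (Fin n)) : ℝ :=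
  ∫ y, scaledKernel n ρ α ‖x - y‖ * E.toFun w y

/-- The regularizing solution `(g - σ ∂_ν R_α[w]) / U` on `∂Ω`, with `U` the exact data and `w` the
noisy data. -/
def regularizedRobin {n : ℕ} {W V : Set (EuclideanSpace ℝ (Fin n))} (ρ : ℝ → ℝ)
    (E : SobolevExtension W V) (ν : EuclideanSpace ℝ (Fin n) → EuclideanSpace ℝ (Fin n))
    (σ g U : EuclideanSpace ℝ (Fin n) → ℝ) (α : ℝ) (w : EuclideanSpace ℝ (Fin n) → ℝ)
    (x : EuclideanSpace ℝ (Fin n)) : ℝ :=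
  (g x - σ x * fderiv ℝ (mollify ρ E α w) x (ν x)) / U x

end RobinInverse

end

/-! On `∂Ω` the Robin condition gives `h^{α,δ} - h = -(σ/u) (∂_ν R_α[U^δ] - ∂_ν u)`, so everything
reduces to two facts: `σ/u` is bounded on `∂Ω`, and the mollified normal derivative is close to `∂_ν
u` in `L²(∂Ω)`.

The first fact is a sign result. If `u` were nonnegative somewhere on `∂Ω`, its maximum over `Ω̄`
would be nonnegative. The strong maximum principle and Hopf's lemma then force `u` to be constant or
`∂_ν u > 0` at a boundary maximum, and both contradict `g ≤ 0`, `g ≢ 0`. Hence `u < 0` on the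
compact set `∂Ω` (`IsRobinSolution.neg_on_frontier`).

For the second fact, additivity of the extension splits `∂ᵢ R_α[U^δ]` into the mollified derivative
of the extended noise and that of the extended exact data. Jensen's inequality and `ρ_α ≤ B α⁻ⁿ`
bound the noise part pointwise by a multiple of `α^{-n/2} δ` (`enorm_convKernel_sq_le_eLpNorm`).

The exact part is off by `O(α^{1/2})` in `L²(∂Ω)` for small `α` (`exists_local_approx`). Move from
`x ∈ ∂Ω` a distance `Lα` into `Ω` along a cone direction. There the support of the kernel lies in
the layer, where the extension is `u`, and the Lipschitz gradient gives a pointwise error `O(α)`.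
The increment of the mollified derivative along the segment is controlled by its line integral, and
Fubini over the Lipschitz graph `∂Ω` (`exists_lintegral_line_le`) turns this into `α^{1/2}` times
the `L²(ℝⁿ)` norm of a second derivative of the extension. No trace theorem is needed.

Since `λ₀ ≤ 1/2`, the approximation error is `O(α^{λ₀})`, also for large `α`, where both terms stay
bounded. The parameter choice balances `α^{-n/2} δ` against `α^{λ₀}`. -/

namespace RobinInverse

open Metric Filter Topology
open scoped NNReal RealInnerProductSpace

/-! ### Boundary geometry: interior cones, Lipschitz graphs, interior balls -/

namespace IsLocalDefiningFunction

variable {n : ℕ} {Ω V : Set (EuclideanSpace ℝ (Fin n))} {x₀ : EuclideanSpace ℝ (Fin n)}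
  {φ : EuclideanSpace ℝ (Fin n) → ℝ}

theorem contDiffAt (hd : IsLocalDefiningFunction Ω x₀ V φ) {y : EuclideanSpace ℝ (Fin n)}
    (hy : y ∈ V) : ContDiffAt ℝ ∞ φ y :=
  hd.smooth.contDiffAt (hd.isOpen.mem_nhds hy)

theorem hasFDerivAt (hd : IsLocalDefiningFunction Ω x₀ V φ) {y : EuclideanSpace ℝ (Fin n)}
    (hy : y ∈ V) : HasFDerivAt φ (fderiv ℝ φ y) y :=
  ((hd.contDiffAt hy).differentiableAt (by simp)).hasFDerivAt

theorem mem_of_neg (hd : IsLocalDefiningFunction Ω x₀ V φ) {y : EuclideanSpace ℝ (Fin n)}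
    (hy : y ∈ V) (h : φ y < 0) : y ∈ Ω := by
  have : y ∈ Ω ∩ V := by rw [hd.inter_eq]; exact ⟨hy, h⟩
  exact this.1

/-- A local defining function vanishes on the boundary. -/
theorem eq_zero (hd : IsLocalDefiningFunction Ω x₀ V φ) (hΩ : IsOpen Ω)
    {y : EuclideanSpace ℝ (Fin n)} (hy : y ∈ V) (hyf : y ∈ frontier Ω) : φ y = 0 := by
  rw [hΩ.frontier_eq] at hyf
  apply le_antisymm
  · by_contra! hpos
    have h1 : ∀ᶠ z in 𝓝 y, 0 < φ z ∧ z ∈ V :=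
      ((hd.contDiffAt hy).continuousAt.eventually (lt_mem_nhds hpos)).and
        (hd.isOpen.mem_nhds hy)
    obtain ⟨z, hz, hzΩ⟩ := mem_closure_iff_nhds.1 hyf.1 _ h1
    have : z ∈ Ω ∩ V := ⟨hzΩ, hz.2⟩
    rw [hd.inter_eq] at this
    exact absurd this.2 (not_lt.2 hz.1.le)
  · by_contra! hneg
    exact hyf.2 (hd.mem_of_neg hy hneg)

/-- Near a boundary point, `∂Ω` satisfies a uniform interior cone condition in a coordinate
direction `e`, and is a Lipschitz graph in that direction. -/
theorem exists_cone (hd : IsLocalDefiningFunction Ω x₀ V φ) (hΩ : IsOpen Ω) :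
    ∃ (i : Fin n) (c r L : ℝ), |c| = 1 ∧ 0 < r ∧ 1 ≤ L ∧
      (∀ x ∈ frontier Ω ∩ ball x₀ r, ∀ t, 0 < t → t < r →
        ball (x - t • (c • stdVec i)) (t / L) ⊆ Ω) ∧
      (∀ x ∈ frontier Ω ∩ ball x₀ r, ∀ y ∈ frontier Ω ∩ ball x₀ r,
        ‖x - y‖ ≤ L * ‖(x - y) - (x i - y i) • stdVec i‖) := by
  have hD0 : fderiv ℝ φ x₀ ≠ 0 := by
    intro h
    apply hd.gradient_ne_zero x₀ hd.mem
    simp [gradient, h]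
  obtain ⟨i, hi⟩ : ∃ i, fderiv ℝ φ x₀ (stdVec i) ≠ 0 := by
    by_contra! hall
    apply hD0
    have : (fderiv ℝ φ x₀ : EuclideanSpace ℝ (Fin n) →ₗ[ℝ] ℝ) = 0 := by
      apply (EuclideanSpace.basisFun (Fin n) ℝ).toBasis.ext
      intro i
      simpa using hall i
    ext v
    exact congrArg (fun f : EuclideanSpace ℝ (Fin n) →ₗ[ℝ] ℝ => f v) this
  obtain ⟨c, hc, hcpos⟩ : ∃ c : ℝ, |c| = 1 ∧ 0 < c * fderiv ℝ φ x₀ (stdVec i) := by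
    rcases lt_or_gt_of_ne hi with h | h
    · exact ⟨-1, by simp, by linarith⟩
    · exact ⟨1, by simp, by linarith⟩
  -- The sign `c` makes `c • stdVec i` point out of `Ω`. Half of the derivative at `x₀` is kept as a
  -- lower bound `a` near `x₀`, with `M` an upper bound for the full derivative there. The cone
  -- aperture is then governed by `L = 1 + M / a`.
  set a := c * fderiv ℝ φ x₀ (stdVec i) / 2 with ha
  have ha0 : 0 < a := by positivity
  set M := ‖fderiv ℝ φ x₀‖ + 1 with hM
  have hM0 : 0 < M := by positivity
  have hcont : ContinuousAt (fderiv ℝ φ) x₀ :=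
    (hd.contDiffAt hd.mem).continuousAt_fderiv (by simp)
  have h1 : ∀ᶠ z in 𝓝 x₀, a < c * fderiv ℝ φ z (stdVec i) := by
    have : ContinuousAt (fun z => c * fderiv ℝ φ z (stdVec i)) x₀ := by fun_prop
    exact this.eventually (lt_mem_nhds (by simp only [ha]; linarith))
  have h2 : ∀ᶠ z in 𝓝 x₀, ‖fderiv ℝ φ z‖ < M :=
    hcont.norm.eventually (gt_mem_nhds (by simp [hM]))
  obtain ⟨R, hR, hball⟩ := Metric.eventually_nhds_iff_ball.1
    ((h1.and h2).and (hd.isOpen.mem_nhds hd.mem))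
  have hmvt : ∀ x ∈ ball x₀ R, ∀ y ∈ ball x₀ R, ∃ z ∈ ball x₀ R,
      φ y - φ x = fderiv ℝ φ z (y - x) := by
    intro x hx y hy
    obtain ⟨z, hz, h⟩ := domain_mvt (f := φ) (f' := fderiv ℝ φ) (s := ball x₀ R)
      (fun z hz => (hd.hasFDerivAt (hball z hz).2).hasFDerivWithinAt) (convex_ball x₀ R) hx hy
    exact ⟨z, (convex_ball x₀ R).segment_subset hx hy hz, h⟩
  have hL1 : 1 ≤ 1 + M / a := by
    have : 0 < M / a := by positivity
    linarith
  have hc' : c * c = 1 := by rw [← abs_mul_abs_self, hc]; norm_num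
  have hrR : ball x₀ (R / 4) ⊆ ball x₀ R := ball_subset_ball (by linarith)
  refine ⟨i, c, R / 4, 1 + M / a, hc, by positivity, hL1, ?_, ?_⟩
  · rintro x ⟨hxf, hxb⟩ t ht htr z hz
    have hxV := (hball x (hrR hxb)).2
    rw [mem_ball, dist_eq_norm] at hz
    set ζ := z - (x - t • (c • stdVec i)) with hζ
    have hzx : z - x = ζ - t • (c • stdVec i) := by rw [hζ]; abel
    have hn : ‖t • (c • (stdVec i : EuclideanSpace ℝ (Fin n)))‖ = t := by
      simp [norm_smul, hc, abs_of_pos ht]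
    have htL : t / (1 + M / a) ≤ t := div_le_self ht.le hL1
    have hzb : z ∈ ball x₀ R := by
      rw [mem_ball, dist_eq_norm] at hxb ⊢
      calc ‖z - x₀‖ = ‖(ζ - t • (c • stdVec i)) + (x - x₀)‖ := by rw [← hzx]; congr 1; abel
        _ ≤ ‖ζ‖ + t + ‖x - x₀‖ := by
          refine (norm_add_le _ _).trans ?_
          gcongr
          exact (norm_sub_le _ _).trans_eq (by rw [hn])
        _ < R := by linarith
    obtain ⟨ξ, hξ, heq⟩ := hmvt x (hrR hxb) z hzb
    refine hd.mem_of_neg (hball z hzb).2 ?_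
    rw [hd.eq_zero hΩ hxV hxf, hzx, map_sub, map_smul, map_smul] at heq
    simp only [smul_eq_mul, sub_zero] at heq
    obtain ⟨⟨hξ1, hξ2⟩, -⟩ := hball ξ hξ
    have hb : fderiv ℝ φ ξ ζ ≤ M * ‖ζ‖ :=
      (le_abs_self _).trans (((fderiv ℝ φ ξ).le_opNorm ζ).trans (by gcongr))
    -- The opening is narrow enough that the gain `t * a` from moving inwards beats the possible
    -- loss `M * ‖ζ‖` from moving sideways, so `φ z < 0`.
    have h3 : M * (t / (1 + M / a)) < t * a := by
      rw [← mul_div_assoc, div_lt_iff₀ (by positivity)]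
      have : t * a * (1 + M / a) = t * a + M * t := by field_simp
      nlinarith [mul_pos ht ha0]
    have h4 : t * a < t * (c * fderiv ℝ φ ξ (stdVec i)) := by gcongr
    have h5 : M * ‖ζ‖ ≤ M * (t / (1 + M / a)) := by gcongr
    linarith
  · rintro x ⟨hxf, hxb⟩ y ⟨hyf, hyb⟩
    obtain ⟨ξ, hξ, heq⟩ := hmvt y (hrR hyb) x (hrR hxb)
    rw [hd.eq_zero hΩ (hball x (hrR hxb)).2 hxf, hd.eq_zero hΩ (hball y (hrR hyb)).2 hyf,
      sub_zero] at heq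
    obtain ⟨⟨hξ1, hξ2⟩, -⟩ := hball ξ hξ
    set τ := x i - y i
    set w := (x - y) - τ • (stdVec i : EuclideanSpace ℝ (Fin n)) with hw
    have hxy : x - y = w + τ • stdVec i := by rw [hw]; abel
    have h3 : |τ| * a ≤ M * ‖w‖ := by
      have h4 : τ * fderiv ℝ φ ξ (stdVec i) = - fderiv ℝ φ ξ w := by
        rw [hxy, map_add, map_smul, smul_eq_mul] at heq
        linarith
      have h5 : |τ| * |fderiv ℝ φ ξ (stdVec i)| ≤ M * ‖w‖ := by
        rw [← abs_mul, h4, abs_neg]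
        exact ((fderiv ℝ φ ξ).le_opNorm w).trans (by gcongr)
      have h6 : a ≤ |fderiv ℝ φ ξ (stdVec i)| := by
        calc a ≤ |c * fderiv ℝ φ ξ (stdVec i)| := hξ1.le.trans (le_abs_self _)
          _ = _ := by rw [abs_mul, hc, one_mul]
      exact (by gcongr : |τ| * a ≤ |τ| * |fderiv ℝ φ ξ (stdVec i)|).trans h5
    calc ‖x - y‖ = ‖w + τ • stdVec i‖ := by rw [hxy]
      _ ≤ ‖w‖ + |τ| := by
        refine (norm_add_le _ _).trans ?_
        simp [norm_smul]
      _ ≤ ‖w‖ + M * ‖w‖ / a := by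
        gcongr
        rwa [le_div_iff₀ ha0]
      _ = (1 + M / a) * ‖w‖ := by ring

end IsLocalDefiningFunction

variable {n : ℕ} {Ω : Set (EuclideanSpace ℝ (Fin n))}

theorem IsOutwardUnitNormal.norm_eq_one {x ν : EuclideanSpace ℝ (Fin n)}
    (h : IsOutwardUnitNormal Ω x ν) : ‖ν‖ = 1 := by
  obtain ⟨V, φ, hd, rfl⟩ := h
  rw [norm_smul, norm_inv, norm_norm]
  exact inv_mul_cancel₀ (norm_ne_zero_iff.2 (hd.gradient_ne_zero x hd.mem))

/-- The interior ball condition at a boundary point. -/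
theorem IsOutwardUnitNormal.exists_interior_ball {x ν : EuclideanSpace ℝ (Fin n)}
    (h : IsOutwardUnitNormal Ω x ν) (hΩ : IsOpen Ω) (hx : x ∈ frontier Ω) :
    ∃ R > 0, ball (x - R • ν) R ⊆ Ω := by
  have hν := h.norm_eq_one
  obtain ⟨V, φ, hd, hνe⟩ := h
  have hgpos : 0 < ‖gradient φ x‖ := norm_pos_iff.2 (hd.gradient_ne_zero x hd.mem)
  have hC1 : ContDiffAt ℝ 1 (fderiv ℝ φ) x :=
    (hd.contDiffAt hd.mem).fderiv_right (m := 1) (by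
      rw [one_add_one_eq_two]; exact WithTop.coe_le_coe.2 (le_top : (2 : ℕ∞) ≤ ⊤))
  obtain ⟨K, t, ht, hK⟩ := hC1.exists_lipschitzOnWith
  obtain ⟨r, hr, hball⟩ := Metric.mem_nhds_iff.1 (inter_mem ht (hd.isOpen.mem_nhds hd.mem))
  -- The first bound keeps the ball inside the region where `fderiv ℝ φ` is `K`-Lipschitz. The
  -- second gives `2 K R < ‖∇φ‖`, so that the linear term of `φ` dominates its quadratic error.
  set R := min (r / 2) (‖gradient φ x‖ / (2 * (K + 1))) with hRdef
  have hR : 0 < R := by positivity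
  refine ⟨R, hR, fun z hz => ?_⟩
  have hRr : 2 * R ≤ r := by linarith [min_le_left (r / 2) (‖gradient φ x‖ / (2 * (K + 1)))]
  have hRK : 2 * K * R < ‖gradient φ x‖ := by
    have h1 : R * (2 * (K + 1)) ≤ ‖gradient φ x‖ := by
      rw [← le_div_iff₀ (by positivity)]; exact min_le_right _ _
    linarith
  rw [mem_ball, dist_eq_norm] at hz
  -- Membership in the ball tangent at `x`, expanded: the quadratic deviation `‖z - x‖²` is absorbed
  -- by the inward component of `z - x`. In the end `φ z ≤ (‖∇φ‖ - 2 K R) ⟪ν, z - x⟫ < 0`.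
  have hin : ‖z - x‖ ^ 2 + 2 * R * ⟪ν, z - x⟫ < 0 := by
    have h1 : ‖(z - x) + R • ν‖ ^ 2 < R ^ 2 := by
      have : z - (x - R • ν) = (z - x) + R • ν := by abel
      rw [← this]; gcongr
    rw [norm_add_sq_real, norm_smul, hν, inner_smul_right, real_inner_comm, Real.norm_eq_abs,
      abs_of_pos hR] at h1
    linarith
  have hzr : z ∈ ball x r := by
    rw [mem_ball, dist_eq_norm]
    calc ‖z - x‖ = ‖(z - (x - R • ν)) - R • ν‖ := by congr 1; abel
      _ ≤ ‖z - (x - R • ν)‖ + R := by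
        refine (norm_sub_le _ _).trans_eq ?_
        simp [norm_smul, hν, abs_of_pos hR]
      _ < r := by linarith
  obtain ⟨ξ, hξ, heq⟩ := domain_mvt (f := φ) (f' := fderiv ℝ φ) (s := ball x r)
      (fun z hz => (hd.hasFDerivAt (hball hz).2).hasFDerivWithinAt) (convex_ball x r)
      (mem_ball_self hr) hzr
  have hξb := (convex_ball x r).segment_subset (mem_ball_self hr) hzr hξ
  have hξx : ‖ξ - x‖ ≤ ‖z - x‖ := by
    have := (convex_closedBall x ‖z - x‖).segment_subset (mem_closedBall_self (norm_nonneg _))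
      (by rw [mem_closedBall, dist_eq_norm]) hξ
    rwa [mem_closedBall, dist_eq_norm] at this
  refine hd.mem_of_neg (hball hzr).2 ?_
  rw [hd.eq_zero hΩ hd.mem hx, sub_zero] at heq
  have h1 : fderiv ℝ φ x (z - x) = ‖gradient φ x‖ * ⟪ν, z - x⟫ := by
    rw [hνe, inner_smul_left, ← mul_assoc]
    simp only [map_inv₀, conj_trivial]
    rw [mul_inv_cancel₀ hgpos.ne', one_mul, gradient, InnerProductSpace.toDual_symm_apply]
  have h2 : fderiv ℝ φ ξ (z - x) - fderiv ℝ φ x (z - x) ≤ K * ‖z - x‖ ^ 2 := by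
    have h3 := hK.dist_le_mul ξ (hball hξb).1 x (hball (mem_ball_self hr)).1
    rw [dist_eq_norm, dist_eq_norm] at h3
    calc fderiv ℝ φ ξ (z - x) - fderiv ℝ φ x (z - x)
        = (fderiv ℝ φ ξ - fderiv ℝ φ x) (z - x) := rfl
      _ ≤ ‖fderiv ℝ φ ξ - fderiv ℝ φ x‖ * ‖z - x‖ :=
        (Real.le_norm_self _).trans (ContinuousLinearMap.le_opNorm _ _)
      _ ≤ (K * ‖z - x‖) * ‖z - x‖ := by
        gcongr
        exact h3.trans (by gcongr)
      _ = _ := by ring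
  have hneg : ⟪ν, z - x⟫ < 0 := by
    by_contra! hge
    have : 0 ≤ 2 * R * ⟪ν, z - x⟫ := by positivity
    linarith [sq_nonneg ‖z - x‖]
  have h4 : (K : ℝ) * ‖z - x‖ ^ 2 ≤ K * (-(2 * R * ⟪ν, z - x⟫)) := by
    gcongr; linarith
  nlinarith [mul_pos_of_neg_of_neg hneg (by linarith : 2 * K * R - ‖gradient φ x‖ < 0)]

namespace IsBoundedSmoothDomain

theorem exists_normal (hΩ : IsBoundedSmoothDomain Ω) {x : EuclideanSpace ℝ (Fin n)}
    (hx : x ∈ frontier Ω) : ∃ ν, IsOutwardUnitNormal Ω x ν := by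
  obtain ⟨V, φ, h⟩ := hΩ.smooth_boundary x hx
  exact ⟨_, V, φ, h, rfl⟩

theorem isCompact_closure (hΩ : IsBoundedSmoothDomain Ω) : IsCompact (closure Ω) :=
  hΩ.isBounded.isCompact_closure

theorem isCompact_frontier (hΩ : IsBoundedSmoothDomain Ω) : IsCompact (frontier Ω) :=
  hΩ.isCompact_closure.of_isClosed_subset isClosed_frontier frontier_subset_closure

/-- A boundary point lies on the closure of an interior ball, which is convex with nonempty
interior, so derivatives within `closure Ω` are unique there. -/
theorem uniqueDiffOn_closure (hΩ : IsBoundedSmoothDomain Ω) : UniqueDiffOn ℝ (closure Ω) := by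
  intro x hx
  by_cases hxΩ : x ∈ Ω
  · exact (hΩ.isOpen.uniqueDiffWithinAt hxΩ).mono subset_closure
  · have hxf : x ∈ frontier Ω := by rw [hΩ.isOpen.frontier_eq]; exact ⟨hx, hxΩ⟩
    obtain ⟨ν, hν⟩ := hΩ.exists_normal hxf
    obtain ⟨R, hR, hball⟩ := hν.exists_interior_ball hΩ.isOpen hxf
    have h1 : UniqueDiffWithinAt ℝ (ball (x - R • ν) R) x := by
      apply uniqueDiffWithinAt_convex (convex_ball _ _)
      · rw [isOpen_ball.interior_eq]; exact ⟨_, mem_ball_self hR⟩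
      · rw [closure_ball _ hR.ne', mem_closedBall, dist_eq_norm]
        simp [norm_smul, hν.norm_eq_one, abs_of_pos hR]
    exact h1.mono (hball.trans subset_closure)

end IsBoundedSmoothDomain

theorem fderivWithin_closure_eq_fderiv {F : Type*} [NormedAddCommGroup F] [NormedSpace ℝ F]
    (hΩ : IsOpen Ω) {f : EuclideanSpace ℝ (Fin n) → F}
    {x : EuclideanSpace ℝ (Fin n)} (hx : x ∈ Ω) :
    fderivWithin ℝ f (closure Ω) x = fderiv ℝ f x :=
  fderivWithin_of_mem_nhds (mem_of_superset (hΩ.mem_nhds hx) subset_closure)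

end RobinInverse

/-! ### Fubini over Lipschitz graphs and finiteness of the surface measure -/

namespace RobinInverse

open Metric Filter Topology
open scoped NNReal

/-- Forgetting the `i`-th coordinate. -/
def dropCoord {m : ℕ} (i : Fin (m + 1)) (x : EuclideanSpace ℝ (Fin (m + 1))) : Fin m → ℝ :=
  fun j => x (i.succAbove j)

theorem continuous_dropCoord {m : ℕ} (i : Fin (m + 1)) : Continuous (dropCoord i) := by
  unfold dropCoord; fun_prop

theorem norm_sub_coord_smul_le {m : ℕ} (i : Fin (m + 1)) (x : EuclideanSpace ℝ (Fin (m + 1))) :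
    ‖x - x i • stdVec i‖ ≤ m * ‖dropCoord i x‖ := by
  have h : x - x i • stdVec i = ∑ j : Fin m, dropCoord i x j • stdVec (i.succAbove j) := by
    have h1 : x = ∑ k, x k • stdVec k := by
      ext j
      simp [Finset.sum_apply, Pi.single_apply]
    conv_lhs => rw [h1, Fin.sum_univ_succAbove _ i]
    simp [dropCoord]
  rw [h]
  refine (norm_sum_le _ _).trans ?_
  calc ∑ j : Fin m, ‖dropCoord i x j • (stdVec (i.succAbove j) : EuclideanSpace ℝ (Fin (m + 1)))‖
      ≤ ∑ _j : Fin m, ‖dropCoord i x‖ := by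
        gcongr with j
        rw [norm_smul]
        simpa using norm_le_pi_norm (dropCoord i x) j
    _ = _ := by simp

/-- The projection is injective on `S` with a `K`-Lipschitz inverse, and a Lipschitz map enlarges
`m`-dimensional Hausdorff measure by at most `K ^ m`. The target is `Fin m → ℝ` with the sup norm
because there Hausdorff measure is exactly Lebesgue measure. -/
theorem map_dropCoord_le {m : ℕ} {i : Fin (m + 1)} {K : ℝ≥0}
    {S : Set (EuclideanSpace ℝ (Fin (m + 1)))}
    (hS : ∀ x ∈ S, ∀ y ∈ S, dist x y ≤ K * dist (dropCoord i x) (dropCoord i y)) :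
    ((Measure.hausdorffMeasure (m : ℝ)).restrict S).map (dropCoord i) ≤
      ((K : ℝ≥0∞) ^ (m : ℝ)) • volume := by
  refine Measure.le_iff.2 fun B hB => ?_
  have hπ := (continuous_dropCoord i).measurable
  rw [Measure.map_apply hπ hB, Measure.restrict_apply (hπ hB), Measure.smul_apply, smul_eq_mul]
  have hinv : ∀ x ∈ S, Function.invFunOn (dropCoord i) S (dropCoord i x) = x := by
    intro x hx
    have h1 := Function.invFunOn_mem (f := dropCoord i) (b := dropCoord i x) ⟨x, hx, rfl⟩
    have h2 := Function.invFunOn_eq (f := dropCoord i) (s := S) (b := dropCoord i x) ⟨x, hx, rfl⟩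
    have h3 := hS _ h1 x hx
    rw [h2, dist_self, mul_zero] at h3
    exact dist_le_zero.1 h3
  have hLip : LipschitzOnWith K (Function.invFunOn (dropCoord i) S) (dropCoord i '' S ∩ B) := by
    refine LipschitzOnWith.of_dist_le_mul ?_
    rintro _ ⟨⟨x, hx, rfl⟩, -⟩ _ ⟨⟨y, hy, rfl⟩, -⟩
    rw [hinv x hx, hinv y hy]
    exact hS x hx y hy
  have hsub : dropCoord i ⁻¹' B ∩ S ⊆
      Function.invFunOn (dropCoord i) S '' (dropCoord i '' S ∩ B) := by
    rintro x ⟨hxB, hxS⟩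
    exact ⟨dropCoord i x, ⟨⟨x, hxS, rfl⟩, hxB⟩, hinv x hxS⟩
  calc _ ≤ _ := measure_mono hsub
    _ ≤ _ := hLip.hausdorffMeasure_image_le (Nat.cast_nonneg m)
    _ ≤ (K : ℝ≥0∞) ^ (m : ℝ) * Measure.hausdorffMeasure (m : ℝ) B := by
      gcongr; exact inter_subset_right
    _ = _ := by
      have := hausdorffMeasure_pi_real (ι := Fin m)
      rw [Fintype.card_fin] at this
      rw [this]

/-- Translation and reflection invariance on `ℝ`: the integral over the whole line depends on `x`
only through its projection, which is what lets it be pushed forward. -/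
theorem lintegral_line_eq {m : ℕ} (i : Fin (m + 1)) {c : ℝ} (hc : |c| = 1)
    (f : EuclideanSpace ℝ (Fin (m + 1)) → ℝ≥0∞) (x : EuclideanSpace ℝ (Fin (m + 1))) :
    ∫⁻ t : ℝ, f (x - t • (c • stdVec i)) =
      ∫⁻ t : ℝ, f (WithLp.toLp 2 (i.insertNth t (dropCoord i x))) := by
  have h1 : ∀ t : ℝ, x + t • stdVec i =
      WithLp.toLp 2 (i.insertNth (x i + t) (dropCoord i x) : Fin (m + 1) → ℝ) := by
    intro t
    ext j
    refine Fin.succAboveCases i ?_ (fun k => ?_) j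
    · simp
    · simp [dropCoord, Fin.succAbove_ne]
  have h2 : ∫⁻ t : ℝ, f (x + t • stdVec i) =
      ∫⁻ t : ℝ, f (WithLp.toLp 2 (i.insertNth t (dropCoord i x))) := by
    simp_rw [h1]
    exact lintegral_add_left_eq_self
      (fun t => f (WithLp.toLp 2 (i.insertNth t (dropCoord i x) : Fin (m + 1) → ℝ))) (x i)
  rw [← h2]
  rcases eq_or_eq_neg_of_abs_eq hc with rfl | rfl
  · have := lintegral_sub_left_eq_self (μ := volume) (fun t : ℝ => f (x + t • stdVec i)) 0
    simpa [sub_eq_add_neg] using this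
  · simp

/-- This plays the role of a trace inequality. The line integral is a function of the projection of
`x`, whose law under the surface measure is at most a constant times Lebesgue measure, and Tonelli
recovers the full volume integral. -/
theorem exists_lintegral_line_le {n : ℕ} {S : Set (EuclideanSpace ℝ (Fin n))} {i : Fin n} {c L : ℝ}
    (hc : |c| = 1) (hL : 0 ≤ L)
    (hS : ∀ x ∈ S, ∀ y ∈ S, ‖x - y‖ ≤ L * ‖(x - y) - (x i - y i) • stdVec i‖) :
    ∃ C : ℝ≥0, ∀ f : EuclideanSpace ℝ (Fin n) → ℝ≥0∞, Measurable f →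
      ∫⁻ x in S, (∫⁻ t : ℝ, f (x - t • (c • stdVec i))) ∂(Measure.euclideanHausdorffMeasure (n - 1))
        ≤ C * ∫⁻ x, f x := by
  obtain ⟨m, rfl⟩ : ∃ m, n = m + 1 := ⟨n - 1, by have := i.pos; omega⟩
  lift L to ℝ≥0 using hL
  have hS' : ∀ x ∈ S, ∀ y ∈ S,
      dist x y ≤ (L * m : ℝ≥0) * dist (dropCoord i x) (dropCoord i y) := by
    intro x hx y hy
    rw [dist_eq_norm, dist_eq_norm]
    refine (hS x hx y hy).trans ?_
    push_cast
    rw [mul_assoc]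
    gcongr
    exact norm_sub_coord_smul_le i (x - y)
  have hmap := map_dropCoord_le hS'
  -- The normalizing factor between the Hausdorff measure and its Euclidean version.
  set a : ℝ≥0 := Measure.addHaarScalarFactor (volume : Measure (EuclideanSpace ℝ (Fin m)))
    (Measure.hausdorffMeasure m)
  have hμ : (Measure.euclideanHausdorffMeasure (m + 1 - 1) :
      Measure (EuclideanSpace ℝ (Fin (m + 1)))) = a • Measure.hausdorffMeasure (m : ℝ) := rfl
  refine ⟨a * (L * m : ℝ≥0) ^ (m : ℝ), fun f hf => ?_⟩
  set F : (Fin m → ℝ) → ℝ≥0∞ := fun z => ∫⁻ t : ℝ, f (WithLp.toLp 2 (i.insertNth t z)) with hF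
  have hmeas : Measurable (fun p : ℝ × (Fin m → ℝ) =>
      f (WithLp.toLp 2 (i.insertNth p.1 p.2 : Fin (m + 1) → ℝ))) := by
    refine hf.comp ((WithLp.measurable_toLp 2 _).comp ?_)
    exact (MeasurableEquiv.piFinSuccAbove (fun _ => ℝ) i).symm.measurable
  have hFm : Measurable F := hmeas.lintegral_prod_left'
  have hfub : ∫⁻ z, F z = ∫⁻ x, f x := by
    rw [hF, ← lintegral_prod_symm _ hmeas.aemeasurable]
    have h1 := (volume_preserving_piFinSuccAbove (fun _ : Fin (m + 1) => ℝ) i).symm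
    have h2 := (PiLp.volume_preserving_toLp (Fin (m + 1))).comp h1
    rw [← h2.lintegral_comp hf]
    rfl
  simp_rw [lintegral_line_eq i hc f]
  rw [hμ, Measure.restrict_smul, lintegral_smul_measure]
  have h3 : ∫⁻ x in S, F (dropCoord i x) ∂(Measure.hausdorffMeasure (m : ℝ)) ≤
      ((L * m : ℝ≥0) : ℝ≥0∞) ^ (m : ℝ) * ∫⁻ x, f x := by
    rw [← lintegral_map hFm (continuous_dropCoord i).measurable, ← hfub]
    calc _ ≤ _ := lintegral_mono' hmap le_rfl
      _ = _ := lintegral_smul_measure _ _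
  calc _ ≤ (a : ℝ≥0∞) * (((L * m : ℝ≥0) : ℝ≥0∞) ^ (m : ℝ) * ∫⁻ x, f x) := by
        rw [ENNReal.smul_def, smul_eq_mul]; gcongr
    _ = _ := by
        simp [mul_assoc]

/-- Locally, the line inequality is applied to the indicator of a slightly larger ball: a line
through a boundary point of the patch spends length at least one in it, so the patch has measure at
most a constant times the volume of that ball. Compactness does the rest. -/
theorem surfaceMeasure_lt_top {n : ℕ} {Ω : Set (EuclideanSpace ℝ (Fin n))}
    (hΩ : IsBoundedSmoothDomain Ω) : surfaceMeasure Ω univ < ⊤ := by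
  rw [surfaceMeasure, Measure.restrict_apply_univ]
  refine hΩ.isCompact_frontier.induction_on
    (p := fun s => Measure.euclideanHausdorffMeasure (n - 1) s < ⊤) (by simp)
    (fun s t hst ht => (measure_mono hst).trans_lt ht)
    (fun s t hs ht => measure_union_lt_top hs ht) fun x₀ hx₀ => ?_
  obtain ⟨V, φ, hd⟩ := hΩ.smooth_boundary x₀ hx₀
  obtain ⟨i, c, r, L, hc, hr, hL, -, hLip⟩ := hd.exists_cone hΩ.isOpen
  set S := frontier Ω ∩ ball x₀ r with hS
  refine ⟨S, inter_mem_nhdsWithin _ (ball_mem_nhds _ hr), ?_⟩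
  obtain ⟨C, hC⟩ := exists_lintegral_line_le (S := S) hc (by linarith) hLip
  set f : EuclideanSpace ℝ (Fin n) → ℝ≥0∞ := (ball x₀ (r + 1)).indicator 1
  have h1 := hC f (measurable_one.indicator measurableSet_ball)
  have h2 : ∀ x ∈ S, 1 ≤ ∫⁻ t : ℝ, f (x - t • (c • stdVec i)) := by
    intro x hx
    calc (1 : ℝ≥0∞) = ∫⁻ t in Ioo (0 : ℝ) 1, 1 := by simp
      _ ≤ ∫⁻ t in Ioo (0 : ℝ) 1, f (x - t • (c • stdVec i)) := by
        refine setLIntegral_mono' measurableSet_Ioo fun t ht => ?_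
        have : x - t • (c • stdVec i) ∈ ball x₀ (r + 1) := by
          rw [mem_ball, dist_eq_norm]
          have hxb := hx.2
          rw [mem_ball, dist_eq_norm] at hxb
          calc ‖x - t • (c • stdVec i) - x₀‖ = ‖(x - x₀) - t • (c • stdVec i)‖ := by
                congr 1; abel
            _ ≤ ‖x - x₀‖ + t := by
              refine (norm_sub_le _ _).trans_eq ?_
              simp [norm_smul, hc, abs_of_pos ht.1]
            _ < r + 1 := by linarith [ht.2]
        simp [f, indicator_of_mem this]
      _ ≤ _ := setLIntegral_le_lintegral _ _
  have hSm : MeasurableSet S := isClosed_frontier.measurableSet.inter measurableSet_ball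
  calc Measure.euclideanHausdorffMeasure (n - 1) S
      = ∫⁻ x in S, 1 ∂(Measure.euclideanHausdorffMeasure (n - 1)) := by simp
    _ ≤ _ := setLIntegral_mono' hSm h2
    _ ≤ _ := h1
    _ = C * volume (ball x₀ (r + 1)) := by
      simp only [f]
      rw [lintegral_indicator_one measurableSet_ball]
    _ < ⊤ := ENNReal.mul_lt_top ENNReal.coe_lt_top measure_ball_lt_top

end RobinInverse

/-! ### Second-order conditions and Hopf's boundary point lemma -/

namespace RobinInverse

open Metric Filter Topology
open scoped NNReal RealInnerProductSpace

variable {n : ℕ}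

theorem differentiableAt_fderiv_apply {w : EuclideanSpace ℝ (Fin n) → ℝ}
    {x : EuclideanSpace ℝ (Fin n)} (hw : ContDiffAt ℝ 2 w x) (e : EuclideanSpace ℝ (Fin n)) :
    DifferentiableAt ℝ (fun y => fderiv ℝ w y e) x := by
  have h1 : ContDiffAt ℝ 1 (fderiv ℝ w) x := hw.fderiv_right (m := 1) (by norm_num)
  exact (h1.differentiableAt (by simp)).clm_apply (differentiableAt_const e)

/-- The second derivative in a direction is nonpositive at a local maximum. -/
theorem fderiv_fderiv_apply_nonpos_of_isLocalMax {w : EuclideanSpace ℝ (Fin n) → ℝ}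
    {x : EuclideanSpace ℝ (Fin n)} (hw : ContDiffAt ℝ 2 w x) (hmax : IsLocalMax w x)
    (e : EuclideanSpace ℝ (Fin n)) : fderiv ℝ (fun y => fderiv ℝ w y e) x e ≤ 0 := by
  by_contra! hpos
  set p : ℝ → EuclideanSpace ℝ (Fin n) := fun t => x + t • e with hp
  have hp0 : p 0 = x := by simp [hp]
  have hpd : ∀ t, HasDerivAt p e t := fun t => by
    simpa [hp] using ((hasDerivAt_id t).smul_const e).const_add x
  have hpc : ContinuousAt p 0 := (hpd 0).continuousAt
  have hdiff : ∀ᶠ y in 𝓝 x, DifferentiableAt ℝ w y :=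
    (hw.eventually (by simp)).mono fun y hy => hy.differentiableAt (by simp)
  have hf1 : ∀ᶠ t in 𝓝 (0 : ℝ), deriv (fun t => w (p t)) t = fderiv ℝ w (p t) e := by
    have := hpc.eventually (by rwa [hp0] : ∀ᶠ y in 𝓝 (p 0), DifferentiableAt ℝ w y)
    filter_upwards [this] with t ht
    exact (ht.hasFDerivAt.comp_hasDerivAt t (hpd t)).deriv
  have hf2 : deriv (deriv fun t => w (p t)) 0 = fderiv ℝ (fun y => fderiv ℝ w y e) x e := by
    rw [EventuallyEq.deriv_eq hf1]
    have h1 : HasFDerivAt (fun y => fderiv ℝ w y e) (fderiv ℝ (fun y => fderiv ℝ w y e) x)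
        (p 0) := by
      rw [hp0]; exact (differentiableAt_fderiv_apply hw e).hasFDerivAt
    exact (h1.comp_hasDerivAt 0 (hpd 0)).deriv
  have hlm : IsLocalMax (fun t => w (p t)) 0 := by
    have : IsLocalMax w (p 0) := by rwa [hp0]
    exact hpc.eventually this
  -- A positive second derivative would make the local maximum also a local minimum. The restriction
  -- to the line is then locally constant and its second derivative vanishes, a contradiction.
  have hlmin : IsLocalMin (fun t => w (p t)) 0 := by
    apply isLocalMin_of_deriv_deriv_pos (hf2 ▸ hpos) hlm.deriv_eq_zero
    exact (ContinuousAt.comp (g := w) (by rw [hp0]; exact hw.continuousAt) hpc)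
  have hconst : (fun t => w (p t)) =ᶠ[𝓝 0] fun _ => w (p 0) := by
    filter_upwards [hlm, hlmin] with t h1 h2 using le_antisymm h1 h2
  have : deriv (deriv fun t => w (p t)) 0 = 0 := by
    rw [hconst.deriv.deriv_eq]; simp
  linarith

/-- The divergence form operator `∇·(σ∇w)`. -/
noncomputable def divGrad (σ w : EuclideanSpace ℝ (Fin n) → ℝ) (x : EuclideanSpace ℝ (Fin n)) : ℝ :=
  ∑ i, fderiv ℝ (fun y => σ y * fderiv ℝ w y (stdVec i)) x (stdVec i)

theorem divGrad_eq {σ w : EuclideanSpace ℝ (Fin n) → ℝ} {x : EuclideanSpace ℝ (Fin n)}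
    (hσ : DifferentiableAt ℝ σ x) (hw : ContDiffAt ℝ 2 w x) :
    divGrad σ w x = ∑ i, (σ x * fderiv ℝ (fun y => fderiv ℝ w y (stdVec i)) x (stdVec i) +
      fderiv ℝ w x (stdVec i) * fderiv ℝ σ x (stdVec i)) := by
  refine Finset.sum_congr rfl fun i _ => ?_
  rw [fderiv_fun_mul hσ (differentiableAt_fderiv_apply hw _)]
  simp

theorem divGrad_nonpos_of_isLocalMax {σ w : EuclideanSpace ℝ (Fin n) → ℝ}
    {x : EuclideanSpace ℝ (Fin n)} (hσ : DifferentiableAt ℝ σ x) (hσ0 : 0 ≤ σ x)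
    (hw : ContDiffAt ℝ 2 w x) (hmax : IsLocalMax w x) : divGrad σ w x ≤ 0 := by
  rw [divGrad_eq hσ hw]
  refine Finset.sum_nonpos fun i _ => ?_
  rw [hmax.fderiv_eq_zero]
  simpa using mul_nonpos_of_nonneg_of_nonpos hσ0
    (fderiv_fderiv_apply_nonpos_of_isLocalMax hw hmax _)

theorem divGrad_add_smul {σ u v : EuclideanSpace ℝ (Fin n) → ℝ} {x : EuclideanSpace ℝ (Fin n)}
    (hσ : DifferentiableAt ℝ σ x) (hu : ContDiffAt ℝ 2 u x) (hv : ContDiffAt ℝ 2 v x) (η : ℝ) :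
    divGrad σ (fun y => u y + η * v y) x = divGrad σ u x + η * divGrad σ v x := by
  have hηv : ContDiffAt ℝ 2 (fun y => η * v y) x := contDiffAt_const.mul hv
  rw [divGrad_eq hσ hu, divGrad_eq hσ hv, divGrad_eq hσ (hu.add hηv), Finset.mul_sum,
    ← Finset.sum_add_distrib]
  refine Finset.sum_congr rfl fun i _ => ?_
  have h1 : (fun y => fderiv ℝ (fun y => u y + η * v y) y (stdVec i)) =ᶠ[𝓝 x]
      fun y => fderiv ℝ u y (stdVec i) + η * fderiv ℝ v y (stdVec i) := by
    filter_upwards [hu.eventually (by simp), hv.eventually (by simp)] with y h1 h2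
    have h1 := h1.differentiableAt (by simp)
    have h2 := h2.differentiableAt (by simp)
    rw [fderiv_fun_add h1 (h2.const_mul η), fderiv_const_mul h2]
    simp
  rw [h1.fderiv_eq, fderiv_fun_add (differentiableAt_fderiv_apply hu _)
    ((differentiableAt_fderiv_apply hv _).const_mul η),
    fderiv_const_mul (differentiableAt_fderiv_apply hv _)]
  have h2 := h1.eq_of_nhds
  rw [h2]
  simp only [_root_.add_apply, _root_.smul_apply, smul_eq_mul]
  ring

/-- The barrier function of the boundary point lemma. -/
noncomputable def barrier (a : ℝ) (y x : EuclideanSpace ℝ (Fin n)) : ℝ := Real.exp (-a * ‖x - y‖ ^ 2)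

theorem contDiff_barrier (a : ℝ) (y : EuclideanSpace ℝ (Fin n)) : ContDiff ℝ 2 (barrier a y) := by
  unfold barrier
  exact (contDiff_const.mul ((contDiff_id.sub contDiff_const).norm_sq ℝ)).exp

theorem hasFDerivAt_barrier (a : ℝ) (y x : EuclideanSpace ℝ (Fin n)) :
    HasFDerivAt (barrier a y) ((-(2 * a) * barrier a y x) • innerSL ℝ (x - y)) x := by
  have h1 : HasFDerivAt (fun x : EuclideanSpace ℝ (Fin n) => x - y)
      (ContinuousLinearMap.id ℝ _) x := (hasFDerivAt_id x).sub_const y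
  have h2 := (h1.norm_sq.const_mul (-a)).exp
  refine h2.congr_fderiv ?_
  ext v
  simp [barrier]
  ring

theorem fderiv_barrier_apply (a : ℝ) (y x : EuclideanSpace ℝ (Fin n)) (i : Fin n) :
    fderiv ℝ (barrier a y) x (stdVec i) = -(2 * a) * barrier a y x * (x i - y i) := by
  rw [(hasFDerivAt_barrier a y x).fderiv]
  simp [PiLp.inner_apply]

theorem fderiv_fderiv_barrier_apply (a : ℝ) (y x : EuclideanSpace ℝ (Fin n)) (i : Fin n) :
    fderiv ℝ (fun x => fderiv ℝ (barrier a y) x (stdVec i)) x (stdVec i) =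
      barrier a y x * (4 * a ^ 2 * (x i - y i) ^ 2 - 2 * a) := by
  simp_rw [fderiv_barrier_apply]
  have h1 : DifferentiableAt ℝ (fun x => -(2 * a) * barrier a y x) x :=
    ((hasFDerivAt_barrier a y x).differentiableAt).const_mul _
  have h2 : HasFDerivAt (fun x : EuclideanSpace ℝ (Fin n) => x i - y i)
      (EuclideanSpace.proj i : EuclideanSpace ℝ (Fin n) →L[ℝ] ℝ) x :=
    ((EuclideanSpace.proj i : EuclideanSpace ℝ (Fin n) →L[ℝ] ℝ).hasFDerivAt).sub_const _
  rw [fderiv_fun_mul h1 h2.differentiableAt, h2.fderiv,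
    fderiv_const_mul (hasFDerivAt_barrier a y x).differentiableAt]
  simp only [_root_.add_apply, _root_.smul_apply, smul_eq_mul,
    fderiv_barrier_apply]
  simp
  ring

theorem divGrad_barrier {σ : EuclideanSpace ℝ (Fin n) → ℝ} {x : EuclideanSpace ℝ (Fin n)}
    (hσ : DifferentiableAt ℝ σ x) (a : ℝ) (y : EuclideanSpace ℝ (Fin n)) :
    divGrad σ (barrier a y) x = 2 * a * barrier a y x *
      (σ x * (2 * a * ‖x - y‖ ^ 2 - n) - fderiv ℝ σ x (x - y)) := by
  have h1 : x - y = ∑ i, (x i - y i) • stdVec i := by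
    ext j
    simp [Finset.sum_apply, Pi.single_apply]
  have h2 : fderiv ℝ σ x (x - y) = ∑ i, (x i - y i) * fderiv ℝ σ x (stdVec i) := by
    conv_lhs => rw [h1]
    simp
  have h3 : ‖x - y‖ ^ 2 = ∑ i, (x i - y i) ^ 2 := by
    rw [EuclideanSpace.real_norm_sq_eq]; simp
  have h4 : (n : ℝ) = ∑ _i : Fin n, (1 : ℝ) := by simp
  rw [divGrad_eq hσ (contDiff_barrier a y).contDiffAt, h2, h3, h4, Finset.mul_sum,
    ← Finset.sum_sub_distrib, Finset.mul_sum, ← Finset.sum_sub_distrib, Finset.mul_sum]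
  refine Finset.sum_congr rfl fun i _ => ?_
  rw [fderiv_fderiv_barrier_apply, fderiv_barrier_apply]
  ring

/-- Hopf's boundary point lemma for `∇·(σ∇u) = 0` in a ball. -/
theorem hopf_boundary_point {σ u : EuclideanSpace ℝ (Fin n) → ℝ} {y z : EuclideanSpace ℝ (Fin n)}
    {R M σ₀ K : ℝ} {D : EuclideanSpace ℝ (Fin n) →L[ℝ] ℝ} (hR : 0 < R) (hσ₀ : 0 < σ₀)
    (hσ : ∀ x ∈ ball y R, DifferentiableAt ℝ σ x) (hσl : ∀ x ∈ ball y R, σ₀ ≤ σ x)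
    (hK : ∀ x ∈ ball y R, ‖fderiv ℝ σ x‖ ≤ K)
    (hu : ∀ x ∈ ball y R, ContDiffAt ℝ 2 u x) (huc : ContinuousOn u (closedBall y R))
    (hpde : ∀ x ∈ ball y R, divGrad σ u x = 0) (hlt : ∀ x ∈ ball y R, u x < M)
    (hle : ∀ x ∈ closedBall y R, u x ≤ M) (hz : ‖z - y‖ = R) (huz : u z = M)
    (hD : HasFDerivWithinAt u D (closedBall y R) z) : 0 < D (z - y) := by
  have hK0 : 0 ≤ K := (norm_nonneg _).trans (hK y (mem_ball_self hR))
  -- Chosen so that `2 a (R/2)² - n = K R / σ₀ + 1`, which makes the barrier a strict subsolution on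
  -- the annulus `R/2 ≤ ‖x - y‖ ≤ R`.
  set a : ℝ := 2 / R ^ 2 * (n + K * R / σ₀ + 1) with ha
  have ha0 : 0 < a := by positivity
  obtain ⟨x₁, hx₁, hmax₁⟩ := (isCompact_closedBall y (R / 2)).exists_isMaxOn
    ⟨y, mem_closedBall_self (by positivity)⟩
    (huc.mono (closedBall_subset_closedBall (by linarith)))
  -- The gap between `M` and the maximum of `u` on the half ball. As the barrier is at most `1`, the
  -- sum `u + η v` does not exceed `M` on the inner sphere.
  set η := M - u x₁ with hη
  have hη0 : 0 < η := by
    have := hlt x₁ (closedBall_subset_ball (by linarith) hx₁)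
    linarith
  set A : Set (EuclideanSpace ℝ (Fin n)) := closedBall y R \ ball y (R / 2) with hA
  have hAc : IsCompact A := (isCompact_closedBall y R).diff isOpen_ball
  have hzA : z ∈ A := by
    refine ⟨by rw [mem_closedBall, dist_eq_norm, hz], ?_⟩
    rw [mem_ball, dist_eq_norm, hz]; linarith
  set v := barrier a y with hv
  set w : EuclideanSpace ℝ (Fin n) → ℝ := fun x => u x + η * v x with hw
  have hwc : ContinuousOn w A := by
    apply (huc.mono sdiff_subset).add
    exact ((contDiff_barrier a y).continuous.const_mul η).continuousOn
  have hvR : ∀ x, ‖x - y‖ = R → v x = v z := by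
    intro x hx
    simp only [hv, barrier, hx, hz]
  -- Subtracting the boundary value of the barrier is unnecessary: it is constant on the outer
  -- sphere, so comparison with `w z = M + η v z` suffices there. An interior maximum is excluded by
  -- `divGrad σ w > 0`.
  have hmaxz : ∀ x ∈ A, w x ≤ w z := by
    obtain ⟨x₂, hx₂, hmax₂⟩ := hAc.exists_isMaxOn ⟨z, hzA⟩ hwc
    suffices h : w x₂ ≤ w z from fun x hx => (hmax₂ hx).trans h
    by_contra! hlt₂
    have hx₂R : ‖x₂ - y‖ ≤ R := by simpa [dist_eq_norm] using hx₂.1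
    have hx₂R' : R / 2 ≤ ‖x₂ - y‖ := by simpa [dist_eq_norm] using hx₂.2
    have hwz : M < w z := by
      simp only [hw, huz]
      have : 0 < η * v z := mul_pos hη0 (Real.exp_pos _)
      linarith
    have hne1 : ‖x₂ - y‖ ≠ R := by
      intro h
      have : w x₂ ≤ w z := by
        simp only [hw, hvR x₂ h, huz]
        linarith [hle x₂ hx₂.1]
      linarith
    have hne2 : ‖x₂ - y‖ ≠ R / 2 := by
      intro h
      have h1 : u x₂ ≤ u x₁ := hmax₁ (by rw [mem_closedBall, dist_eq_norm, h])
      have h2 : v x₂ ≤ 1 := by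
        simp only [hv, barrier]
        exact Real.exp_le_one_iff.2 (by nlinarith [sq_nonneg ‖x₂ - y‖])
      have : w x₂ ≤ M := by
        simp only [hw]
        nlinarith
      linarith
    have hlt1 : ‖x₂ - y‖ < R := lt_of_le_of_ne hx₂R hne1
    have hlt2 : R / 2 < ‖x₂ - y‖ := lt_of_le_of_ne hx₂R' hne2.symm
    have hx₂b : x₂ ∈ ball y R := by rwa [mem_ball, dist_eq_norm]
    have hnhds : A ∈ 𝓝 x₂ := by
      have h1 : ∀ᶠ x in 𝓝 x₂, R / 2 < ‖x - y‖ :=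
        (by fun_prop : ContinuousAt (fun x => ‖x - y‖) x₂).eventually (lt_mem_nhds hlt2)
      filter_upwards [h1, isOpen_ball.mem_nhds hx₂b] with x h1 h2
      refine ⟨ball_subset_closedBall h2, ?_⟩
      rw [mem_ball, dist_eq_norm]; linarith
    have hloc : IsLocalMax w x₂ := hmax₂.isLocalMax hnhds
    have hvC : ContDiffAt ℝ 2 v x₂ := (contDiff_barrier a y).contDiffAt
    have h1 := divGrad_nonpos_of_isLocalMax (hσ x₂ hx₂b) (hσ₀.le.trans (hσl x₂ hx₂b))
      ((hu x₂ hx₂b).add (contDiffAt_const.mul hvC)) hloc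
    rw [divGrad_add_smul (hσ x₂ hx₂b) (hu x₂ hx₂b) hvC, hpde x₂ hx₂b, zero_add,
      divGrad_barrier (hσ x₂ hx₂b)] at h1
    have h2 : fderiv ℝ σ x₂ (x₂ - y) ≤ K * R :=
      (le_abs_self _).trans (((fderiv ℝ σ x₂).le_opNorm _).trans
        (mul_le_mul (hK x₂ hx₂b) hx₂R (norm_nonneg _) hK0))
    have h3 : K * R / σ₀ + 1 ≤ 2 * a * ‖x₂ - y‖ ^ 2 - n := by
      have h4 : (R / 2) ^ 2 ≤ ‖x₂ - y‖ ^ 2 := by gcongr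
      have h5 : 2 * a * (R / 2) ^ 2 = n + K * R / σ₀ + 1 := by
        rw [ha]; field_simp
      nlinarith
    have h6 : K * R + σ₀ ≤ σ x₂ * (2 * a * ‖x₂ - y‖ ^ 2 - n) := by
      calc K * R + σ₀ = σ₀ * (K * R / σ₀ + 1) := by field_simp
        _ ≤ σ x₂ * (2 * a * ‖x₂ - y‖ ^ 2 - n) := by
          have : 0 ≤ K * R / σ₀ + 1 := by positivity
          have := hσl x₂ hx₂b
          gcongr
          linarith
    have h7 : 0 < η * (2 * a * barrier a y x₂ *
        (σ x₂ * (2 * a * ‖x₂ - y‖ ^ 2 - n) - fderiv ℝ σ x₂ (x₂ - y))) := by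
      have h8 : 0 < barrier a y x₂ := Real.exp_pos _
      have h9 : 0 < σ x₂ * (2 * a * ‖x₂ - y‖ ^ 2 - n) - fderiv ℝ σ x₂ (x₂ - y) := by linarith
      positivity
    linarith
  have hDw : HasFDerivWithinAt w
      (D + η • ((-(2 * a) * v z) • innerSL ℝ (z - y))) A z :=
    (hD.mono sdiff_subset).add ((hasFDerivAt_barrier a y z).const_mul η).hasFDerivWithinAt
  -- The inward radius may be followed for half its length before leaving the annulus, so the
  -- one-sided first-order condition applies in this direction and yields `D (z - y) ≥ 2 a η v(z)
  -- R²`.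
  have hseg : segment ℝ z (z + (-(1 / 2 : ℝ)) • (z - y)) ⊆ A := by
    rw [segment_eq_image']
    rintro _ ⟨t, ht, rfl⟩
    have h1 : ‖z + t • (z + (-(1 / 2 : ℝ)) • (z - y) - z) - y‖ = (1 - t / 2) * R := by
      have : z + t • (z + (-(1 / 2 : ℝ)) • (z - y) - z) - y = (1 - t / 2) • (z - y) := by
        module
      rw [this, norm_smul, hz, Real.norm_eq_abs, abs_of_nonneg (by linarith [ht.2])]
    refine ⟨?_, ?_⟩
    · rw [mem_closedBall, dist_eq_norm]
      simp only [] at h1 ⊢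
      rw [h1]; nlinarith [ht.1]
    · rw [mem_ball, dist_eq_norm]
      simp only [] at h1 ⊢
      rw [h1]; nlinarith [ht.2]
  have hfin := IsLocalMaxOn.hasFDerivWithinAt_nonpos
    (eventually_nhdsWithin_of_forall hmaxz : IsLocalMaxOn w A z) hDw
    (mem_posTangentConeAt_of_segment_subset hseg)
  have hvz : 0 < v z := Real.exp_pos _
  simp only [map_smul, _root_.add_apply, _root_.smul_apply,
    innerSL_apply_apply, real_inner_self_eq_norm_sq, hz, smul_eq_mul] at hfin
  have : 0 < η * (2 * a * v z * R ^ 2) := by positivity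
  linarith

end RobinInverse

/-! ### Strong maximum principle and the sign of the solution -/

namespace RobinInverse

open Metric Filter Topology
open scoped NNReal RealInnerProductSpace

variable {n : ℕ}

/-- The strong maximum principle for `∇·(σ∇u) = 0`. -/
theorem eq_max_of_mem {Ω : Set (EuclideanSpace ℝ (Fin n))} {σ u : EuclideanSpace ℝ (Fin n) → ℝ}
    {M σ₀ K : ℝ} (hΩ : IsOpen Ω) (hconn : IsPreconnected Ω) (hσ₀ : 0 < σ₀)
    (hσ : ∀ x ∈ Ω, DifferentiableAt ℝ σ x) (hσl : ∀ x ∈ Ω, σ₀ ≤ σ x)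
    (hK : ∀ x ∈ Ω, ‖fderiv ℝ σ x‖ ≤ K) (hu : ∀ x ∈ Ω, ContDiffAt ℝ 2 u x)
    (hpde : ∀ x ∈ Ω, divGrad σ u x = 0) (hle : ∀ x ∈ Ω, u x ≤ M)
    {p : EuclideanSpace ℝ (Fin n)} (hp : p ∈ Ω) (hpM : u p = M) : ∀ x ∈ Ω, u x = M := by
  have huc : ContinuousOn u Ω := fun x hx => (hu x hx).continuousAt.continuousWithinAt
  set U : Set (EuclideanSpace ℝ (Fin n)) := {x ∈ Ω | u x = M} with hU
  suffices h : Ω ⊆ U from fun x hx => (h hx).2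
  apply hconn.subset_of_closure_inter_subset
  · rw [isOpen_iff_mem_nhds]
    rintro p ⟨hpΩ, hpM⟩
    obtain ⟨r, hr, hball⟩ := nhds_basis_closedBall.mem_iff.1 (hΩ.mem_nhds hpΩ)
    refine mem_of_superset (ball_mem_nhds p (half_pos hr)) fun y hy => ?_
    have hyp : dist y p < r / 2 := hy
    have hyΩ : y ∈ Ω := hball (ball_subset_closedBall (ball_subset_ball (by linarith) hy))
    refine ⟨hyΩ, ?_⟩
    by_contra hne
    -- Let `z` be a point of the contact set nearest to `y`. The open ball about `y` through `z`
    -- contains no contact point, so Hopf gives a nonzero derivative at `z`, which is an interior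
    -- maximum. Taking `y` within `r / 2` of `p` keeps that ball inside `closedBall p r`.
    have hF : IsCompact (closedBall p r ∩ u ⁻¹' {M}) :=
      (isCompact_closedBall p r).of_isClosed_subset
        ((huc.mono hball).preimage_isClosed_of_isClosed isClosed_closedBall isClosed_singleton)
        inter_subset_left
    obtain ⟨z, ⟨hzb, hzM⟩, hzmin⟩ := hF.exists_isMinOn ⟨p, mem_closedBall_self hr.le, hpM⟩
      (f := fun z => dist z y) (by fun_prop)
    have hdp : dist z y ≤ dist p y := hzmin (⟨mem_closedBall_self hr.le, hpM⟩)
    have hzy : z ≠ y := by rintro rfl; exact hne hzM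
    have hd : 0 < dist z y := dist_pos.2 hzy
    have hsub : closedBall y (dist z y) ⊆ closedBall p r := by
      apply closedBall_subset_closedBall'
      rw [dist_comm p y] at hdp
      linarith
    have hsub' : ball y (dist z y) ⊆ Ω := ball_subset_closedBall.trans (hsub.trans hball)
    have hzΩ : z ∈ Ω := hball hzb
    have hloc : IsLocalMax u z := by
      filter_upwards [hΩ.mem_nhds hzΩ] with x hx
      rw [show u z = M from hzM]; exact hle x hx
    have := hopf_boundary_point (z := z) (D := fderiv ℝ u z) hd hσ₀ (fun x hx => hσ x (hsub' hx))
      (fun x hx => hσl x (hsub' hx)) (fun x hx => hK x (hsub' hx)) (fun x hx => hu x (hsub' hx))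
      (huc.mono (hsub.trans hball)) (fun x hx => hpde x (hsub' hx))
      (fun x hx => lt_of_le_of_ne (hle x (hsub' hx)) fun hxM => by
        have h1 : dist z y ≤ dist x y := hzmin ⟨hsub (ball_subset_closedBall hx), hxM⟩
        rw [mem_ball] at hx
        linarith)
      (fun x hx => hle x (hball (hsub hx))) (dist_eq_norm z y).symm hzM
      ((hu z hzΩ).differentiableAt (by simp)).hasFDerivAt.hasFDerivWithinAt
    rw [hloc.fderiv_eq_zero] at this
    simp at this
  · exact ⟨p, hp, hp, hpM⟩
  · rintro x ⟨hxU, hxΩ⟩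
    refine ⟨hxΩ, ?_⟩
    have h1 : MapsTo u U {M} := fun y hy => hy.2
    have h2 := (huc x hxΩ).mono (fun y hy => hy.1 : U ⊆ Ω)
    simpa using h2.mem_closure hxU h1

/-- Uniform bound of the derivative of a `C¹` function on a compact closure. -/
theorem IsBoundedSmoothDomain.exists_fderivWithin_bound {F : Type*} [NormedAddCommGroup F]
    [NormedSpace ℝ F] {Ω : Set (EuclideanSpace ℝ (Fin n))} (hΩ : IsBoundedSmoothDomain Ω)
    {f : EuclideanSpace ℝ (Fin n) → F} (hf : ContDiffOn ℝ 1 f (closure Ω)) :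
    ∃ K : ℝ, ∀ x ∈ closure Ω, ‖fderivWithin ℝ f (closure Ω) x‖ ≤ K := by
  obtain ⟨K, hK⟩ := hΩ.isCompact_closure.exists_bound_of_continuousOn
    (hf.continuousOn_fderivWithin hΩ.uniqueDiffOn_closure (by simp))
  exact ⟨K, hK⟩

theorem contDiffAt_of_contDiffOn_closure {Ω : Set (EuclideanSpace ℝ (Fin n))} (hΩ : IsOpen Ω)
    {F : Type*} [NormedAddCommGroup F] [NormedSpace ℝ F]
    {f : EuclideanSpace ℝ (Fin n) → F} {m : WithTop ℕ∞} (hf : ContDiffOn ℝ m f (closure Ω))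
    {x : EuclideanSpace ℝ (Fin n)} (hx : x ∈ Ω) : ContDiffAt ℝ m f x :=
  hf.contDiffAt (mem_of_superset (hΩ.mem_nhds hx) subset_closure)

/-- The solution of the Robin problem with `g ≤ 0`, `g ≢ 0` is negative on the boundary. -/
theorem IsRobinSolution.neg_on_frontier {Ω : Set (EuclideanSpace ℝ (Fin n))}
    {ν : EuclideanSpace ℝ (Fin n) → EuclideanSpace ℝ (Fin n)}
    {σ h g u : EuclideanSpace ℝ (Fin n) → ℝ} (hsol : IsRobinSolution Ω ν σ h g u)
    (hΩ : IsBoundedSmoothDomain Ω) (hν : ∀ x ∈ frontier Ω, IsOutwardUnitNormal Ω x (ν x))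
    (hσ : ContDiffOn ℝ 1 σ (closure Ω)) (hσ_pos : ∀ x ∈ closure Ω, 0 < σ x)
    (hh_pos : ∀ x ∈ frontier Ω, 0 < h x) (hg_nonpos : ∀ x ∈ frontier Ω, g x ≤ 0)
    (hg_ne : ∃ x ∈ frontier Ω, g x ≠ 0) (hu : ContDiffOn ℝ 2 u (closure Ω)) :
    ∀ x ∈ frontier Ω, u x < 0 := by
  have hne : (closure Ω).Nonempty := hΩ.isConnected.nonempty.closure
  obtain ⟨y₀, hy₀, hmin⟩ := hΩ.isCompact_closure.exists_isMinOn hne hσ.continuousOn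
  obtain ⟨K, hK⟩ := hΩ.exists_fderivWithin_bound hσ
  have hσd : ∀ x ∈ Ω, DifferentiableAt ℝ σ x := fun x hx =>
    (contDiffAt_of_contDiffOn_closure hΩ.isOpen hσ hx).differentiableAt (by simp)
  have hσl : ∀ x ∈ Ω, σ y₀ ≤ σ x := fun x hx => hmin (subset_closure hx)
  have hK' : ∀ x ∈ Ω, ‖fderiv ℝ σ x‖ ≤ K := fun x hx => by
    rw [← fderivWithin_closure_eq_fderiv hΩ.isOpen hx]; exact hK x (subset_closure hx)
  have hu' : ∀ x ∈ Ω, ContDiffAt ℝ 2 u x := fun x hx =>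
    contDiffAt_of_contDiffOn_closure hΩ.isOpen hu hx
  have hpde : ∀ x ∈ Ω, divGrad σ u x = 0 := fun x hx => neg_eq_zero.1 (hsol.pde x hx)
  intro x₀ hx₀
  by_contra! hx₀u
  obtain ⟨x₁, hx₁, hmax⟩ := hΩ.isCompact_closure.exists_isMaxOn hne hu.continuousOn
  have hM0 : 0 ≤ u x₁ := hx₀u.trans (hmax (frontier_subset_closure hx₀))
  -- Interior maximum: `u` is a constant `M ≥ 0`, so `g = h M ≥ 0`, against `g ≤ 0`, `g ≢ 0`.
  -- Boundary maximum only: Hopf in an interior ball gives `∂_ν u > 0`, so `g > 0` at that point.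
  by_cases hex : ∃ p ∈ Ω, u p = u x₁
  · obtain ⟨p, hp, hpM⟩ := hex
    have hall := eq_max_of_mem hΩ.isOpen hΩ.isConnected.isPreconnected (hσ_pos y₀ hy₀) hσd hσl hK'
      hu' hpde (fun x hx => hmax (subset_closure hx)) hp hpM
    have hall' : EqOn u (fun _ => u x₁) (closure Ω) :=
      EqOn.of_subset_closure (s := Ω) hall hu.continuousOn continuousOn_const subset_closure
        subset_rfl
    obtain ⟨x, hx, hgx⟩ := hg_ne
    have hb := hsol.boundary x hx
    have hxc := frontier_subset_closure hx
    rw [fderivWithin_congr hall' (hall' hxc), hall' hxc] at hb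
    simp only [fderivWithin_fun_const, Pi.zero_apply, _root_.zero_apply, mul_zero, zero_add] at hb
    have h1 : g x < 0 := lt_of_le_of_ne (hg_nonpos x hx) hgx
    have h2 : 0 ≤ h x * u x₁ := mul_nonneg (hh_pos x hx).le hM0
    linarith
  · push Not at hex
    have hx₁f : x₁ ∈ frontier Ω := by
      rw [hΩ.isOpen.frontier_eq]
      exact ⟨hx₁, fun h => hex x₁ h rfl⟩
    have hν₁ := hν x₁ hx₁f
    obtain ⟨R, hR, hball⟩ := hν₁.exists_interior_ball hΩ.isOpen hx₁f
    have hcb : closedBall (x₁ - R • ν x₁) R ⊆ closure Ω := by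
      rw [← closure_ball _ hR.ne']; exact closure_mono hball
    have hzy : x₁ - (x₁ - R • ν x₁) = R • ν x₁ := by abel
    have := hopf_boundary_point (z := x₁) (D := fderivWithin ℝ u (closure Ω) x₁) hR (hσ_pos y₀ hy₀)
      (fun x hx => hσd x (hball hx)) (fun x hx => hσl x (hball hx)) (fun x hx => hK' x (hball hx))
      (fun x hx => hu' x (hball hx)) (hu.continuousOn.mono hcb) (fun x hx => hpde x (hball hx))
      (fun x hx => lt_of_le_of_ne (hmax (subset_closure (hball hx))) (hex x (hball hx)))
      (fun x hx => hmax (hcb hx))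
      (by rw [hzy, norm_smul, hν₁.norm_eq_one, Real.norm_eq_abs, abs_of_pos hR, mul_one]) rfl
      (((hu x₁ hx₁).differentiableWithinAt (by simp)).hasFDerivWithinAt.mono hcb)
    rw [hzy, map_smul, smul_eq_mul] at this
    have h1 : 0 < fderivWithin ℝ u (closure Ω) x₁ (ν x₁) := pos_of_mul_pos_right this hR.le
    have h2 := hsol.boundary x₁ hx₁f
    have h3 := mul_pos (hσ_pos x₁ hx₁) h1
    have h4 := mul_nonneg (hh_pos x₁ hx₁f).le hM0
    linarith [hg_nonpos x₁ hx₁f]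

end RobinInverse

/-! ### Weak derivatives and Sobolev membership -/

namespace RobinInverse

open Metric Filter Topology
open scoped NNReal

variable {n : ℕ} {W : Set (EuclideanSpace ℝ (Fin n))} {i : Fin n}
  {f g f' g' : EuclideanSpace ℝ (Fin n) → ℝ}

theorem integrable_mul_of_tsupport_subset (hf : LocallyIntegrableOn f W)
    {φ : EuclideanSpace ℝ (Fin n) → ℝ} (hφ : Continuous φ) (hc : HasCompactSupport φ)
    (hs : tsupport φ ⊆ W) : Integrable (fun x => f x * φ x) := by
  have h1 : IntegrableOn f (tsupport φ) := hf.integrableOn_compact_subset hs hc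
  have h2 : IntegrableOn (fun x => f x * φ x) (tsupport φ) :=
    h1.mul_continuousOn hφ.continuousOn hc
  refine (integrableOn_iff_integrable_of_support_subset fun x hx => subset_tsupport φ ?_).1 h2
  exact right_ne_zero_of_mul hx

theorem setIntegral_mul_eq_integral (f : EuclideanSpace ℝ (Fin n) → ℝ)
    {φ : EuclideanSpace ℝ (Fin n) → ℝ} (hs : tsupport φ ⊆ W) :
    ∫ x in W, f x * φ x = ∫ x, f x * φ x :=
  setIntegral_eq_integral_of_forall_compl_eq_zero fun x hx => by
    rw [image_eq_zero_of_notMem_tsupport fun h => hx (hs h), mul_zero]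

theorem tsupport_fderiv_apply_stdVec_subset (φ : EuclideanSpace ℝ (Fin n) → ℝ)
    (e : EuclideanSpace ℝ (Fin n)) : tsupport (fun x => fderiv ℝ φ x e) ⊆ tsupport φ := by
  refine (closure_mono fun x hx => ?_).trans (tsupport_fderiv_subset ℝ (f := φ))
  simp only [Function.mem_support] at hx ⊢
  intro h
  rw [h] at hx
  simp at hx

/-- The fundamental lemma of the calculus of variations. It makes the chosen representative
`weakPartial` interchangeable with any explicit weak derivative. -/
theorem HasWeakPartial.ae_eq (hW : IsOpen W) (h : HasWeakPartial W i f g)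
    (h' : HasWeakPartial W i f g') : g =ᵐ[volume.restrict W] g' := by
  have key := hW.ae_eq_zero_of_integral_contDiff_smul_eq_zero (μ := volume)
    (h.locInt_deriv.sub h'.locInt_deriv) fun φ hφ hc hs => by
      have h1 := h.integral_eq φ hφ hc hs
      rw [h'.integral_eq φ hφ hc hs, setIntegral_mul_eq_integral _ hs,
        setIntegral_mul_eq_integral _ hs, neg_inj] at h1
      calc ∫ x, φ x • (g - g') x = ∫ x, (g x * φ x - g' x * φ x) := by
            congr 1; ext x; simp; ring
        _ = 0 := by
          rw [integral_sub
            (integrable_mul_of_tsupport_subset h.locInt_deriv hφ.continuous hc hs)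
            (integrable_mul_of_tsupport_subset h'.locInt_deriv hφ.continuous hc hs), h1,
            sub_self]
  rw [EventuallyEq, ae_restrict_iff' hW.measurableSet]
  filter_upwards [key] with x hx hxW
  exact sub_eq_zero.1 (hx hxW)

theorem LocallyIntegrableOn.congr_ae_restrict (h : LocallyIntegrableOn f W)
    (hff' : f =ᵐ[volume.restrict W] f') : LocallyIntegrableOn f' W := by
  intro x hx
  obtain ⟨s, hs, hi⟩ := h x hx
  exact ⟨s ∩ W, inter_mem hs self_mem_nhdsWithin, (hi.mono_set inter_subset_left).congr_fun_ae
    (ae_restrict_of_ae_restrict_of_subset inter_subset_right hff')⟩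

theorem HasWeakPartial.congr (h : HasWeakPartial W i f g) (hff' : f =ᵐ[volume.restrict W] f')
    (hgg' : g =ᵐ[volume.restrict W] g') : HasWeakPartial W i f' g' where
  locInt_fun := LocallyIntegrableOn.congr_ae_restrict h.locInt_fun hff'
  locInt_deriv := LocallyIntegrableOn.congr_ae_restrict h.locInt_deriv hgg'
  integral_eq φ hφ hc hs := by
    have h1 : (fun x => f x * fderiv ℝ φ x (stdVec i)) =ᵐ[volume.restrict W]
        fun x => f' x * fderiv ℝ φ x (stdVec i) := hff'.mul EventuallyEq.rfl
    have h2 : (fun x => g x * φ x) =ᵐ[volume.restrict W] fun x => g' x * φ x :=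
      hgg'.mul EventuallyEq.rfl
    rw [← integral_congr_ae h1, ← integral_congr_ae h2]
    exact h.integral_eq φ hφ hc hs

theorem HasWeakPartial.sub (h : HasWeakPartial W i f g)
    (h' : HasWeakPartial W i f' g') :
    HasWeakPartial W i (fun x => f x - f' x) (fun x => g x - g' x) where
  locInt_fun := h.locInt_fun.sub h'.locInt_fun
  locInt_deriv := h.locInt_deriv.sub h'.locInt_deriv
  integral_eq φ hφ hc hs := by
    have hs' := (tsupport_fderiv_apply_stdVec_subset φ (stdVec i)).trans hs
    have hc' : HasCompactSupport fun x => fderiv ℝ φ x (stdVec i) := hc.fderiv_apply ℝ _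
    have hφ' : Continuous fun x => fderiv ℝ φ x (stdVec i) :=
      (hφ.continuous_fderiv (by simp)).clm_apply continuous_const
    have h1 := h.integral_eq φ hφ hc hs
    have h2 := h'.integral_eq φ hφ hc hs
    rw [setIntegral_mul_eq_integral _ hs', setIntegral_mul_eq_integral _ hs] at h1 h2 ⊢
    simp_rw [sub_mul]
    rw [integral_sub (integrable_mul_of_tsupport_subset h.locInt_fun hφ' hc' hs')
      (integrable_mul_of_tsupport_subset h'.locInt_fun hφ' hc' hs'),
      integral_sub (integrable_mul_of_tsupport_subset h.locInt_deriv hφ.continuous hc hs)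
      (integrable_mul_of_tsupport_subset h'.locInt_deriv hφ.continuous hc hs), h1, h2]
    ring

theorem HasWeakPartial.restrict (h : HasWeakPartial univ i f g) : HasWeakPartial W i f g where
  locInt_fun := h.locInt_fun.mono_set (subset_univ _)
  locInt_deriv := h.locInt_deriv.mono_set (subset_univ _)
  integral_eq φ hφ hc hs := by
    have h1 := h.integral_eq φ hφ hc (subset_univ _)
    rw [setIntegral_mul_eq_integral _ ((tsupport_fderiv_apply_stdVec_subset φ _).trans hs),
      setIntegral_mul_eq_integral _ hs]
    rwa [setIntegral_univ, setIntegral_univ] at h1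

/-- Classical partial derivatives are weak partial derivatives. -/
theorem hasWeakPartial_fderiv (hW : IsOpen W) (hf : ContDiffOn ℝ 1 f W) (i : Fin n) :
    HasWeakPartial W i f (fun x => fderiv ℝ f x (stdVec i)) := by
  have h1 : LocallyIntegrableOn f W :=
    hf.continuousOn.locallyIntegrableOn hW.measurableSet
  have h2 : LocallyIntegrableOn (fun x => fderiv ℝ f x (stdVec i)) W :=
    ((hf.continuousOn_fderiv_of_isOpen hW (by simp)).clm_apply
      continuousOn_const).locallyIntegrableOn hW.measurableSet
  refine ⟨h1, h2, fun φ hφ hc hs => ?_⟩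
  have hs' := (tsupport_fderiv_apply_stdVec_subset φ (stdVec i)).trans hs
  rw [setIntegral_mul_eq_integral _ hs', setIntegral_mul_eq_integral _ hs]
  refine integral_mul_fderiv_eq_neg_fderiv_mul_of_integrable
    (integrable_mul_of_tsupport_subset h2 hφ.continuous hc hs)
    (integrable_mul_of_tsupport_subset h1
      ((hφ.continuous_fderiv (by simp)).clm_apply continuous_const) (hc.fderiv_apply ℝ _) hs')
    (integrable_mul_of_tsupport_subset h1 hφ.continuous hc hs) (fun x hx => ?_)
    (fun x _ => hφ.differentiable (by simp) x)
  exact (hf.contDiffAt (hW.mem_nhds (hs hx))).differentiableAt (by simp)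

theorem hasWeakPartial_weakPartial (h : ∃ g, HasWeakPartial W i f g) :
    HasWeakPartial W i f (weakPartial W i f) := by
  rw [weakPartial, dif_pos h]; exact h.choose_spec

theorem MemH1.hasWeakPartial (h : MemH1 W f) (i : Fin n) :
    HasWeakPartial W i f (weakPartial W i f) :=
  hasWeakPartial_weakPartial (h.2 i).1

theorem memH1_of_hasWeakPartial (hW : IsOpen W) (hf : MemLp f 2 (volume.restrict W))
    {G : Fin n → EuclideanSpace ℝ (Fin n) → ℝ} (hG : ∀ i, HasWeakPartial W i f (G i))
    (hG2 : ∀ i, MemLp (G i) 2 (volume.restrict W)) : MemH1 W f :=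
  ⟨hf, fun i => ⟨⟨_, hG i⟩, (hG2 i).ae_eq
    ((hG i).ae_eq hW (hasWeakPartial_weakPartial ⟨_, hG i⟩))⟩⟩

theorem MemH1.sub (hW : IsOpen W) (hf : MemH1 W f) (hg : MemH1 W g) :
    MemH1 W (fun x => f x - g x) :=
  memH1_of_hasWeakPartial hW (hf.1.sub hg.1)
    (fun i => (hf.hasWeakPartial i).sub (hg.hasWeakPartial i))
    (fun i => (hf.2 i).2.sub (hg.2 i).2)

theorem MemH1.congr (hW : IsOpen W) (hf : MemH1 W f) (hfg : f =ᵐ[volume.restrict W] g) :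
    MemH1 W g :=
  memH1_of_hasWeakPartial hW (hf.1.ae_eq hfg)
    (fun i => (hf.hasWeakPartial i).congr hfg EventuallyEq.rfl) (fun i => (hf.2 i).2)

theorem eLpNorm_weakPartial_le_h1Norm (f : EuclideanSpace ℝ (Fin n) → ℝ) (i : Fin n) :
    eLpNorm (weakPartial W i f) 2 (volume.restrict W) ≤ h1Norm W f := by
  have h1 : eLpNorm (weakPartial W i f) 2 (volume.restrict W) =
      (eLpNorm (weakPartial W i f) 2 (volume.restrict W) ^ 2) ^ (1 / 2 : ℝ) := by
    rw [← ENNReal.rpow_natCast, ← ENNReal.rpow_mul]; simp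
  rw [h1, h1Norm]
  gcongr
  exact (Finset.single_le_sum
    (f := fun i => eLpNorm (weakPartial W i f) 2 (volume.restrict W) ^ 2)
    (fun _ _ => zero_le) (Finset.mem_univ i)).trans le_add_self

theorem memH1_of_contDiffOn (hW : IsOpen W) (hWb : Bornology.IsBounded W)
    (hf : ContDiffOn ℝ 1 f W) {K : ℝ} (hK : ∀ x ∈ W, ‖f x‖ ≤ K)
    (hK' : ∀ x ∈ W, ‖fderiv ℝ f x‖ ≤ K) : MemH1 W f := by
  have : IsFiniteMeasure ((volume : Measure (EuclideanSpace ℝ (Fin n))).restrict W) :=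
    ⟨by simpa using hWb.measure_lt_top⟩
  refine memH1_of_hasWeakPartial hW ?_ (hasWeakPartial_fderiv hW hf) fun i => ?_
  · exact MemLp.of_bound (hf.continuousOn.aestronglyMeasurable hW.measurableSet) K
      ((ae_restrict_iff' hW.measurableSet).2 (Eventually.of_forall hK))
  · refine MemLp.of_bound (((hf.continuousOn_fderiv_of_isOpen hW (by simp)).clm_apply
      continuousOn_const).aestronglyMeasurable hW.measurableSet) K
      ((ae_restrict_iff' hW.measurableSet).2 (Eventually.of_forall fun x hx => ?_))
    refine ((fderiv ℝ f x).le_opNorm _).trans ?_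
    simpa using hK' x hx

/-- A `C²(Ω̄)` function belongs to `H²(W)` for open `W ⊆ Ω`. -/
theorem memH2_of_contDiffOn_closure {Ω : Set (EuclideanSpace ℝ (Fin n))}
    (hΩ : IsBoundedSmoothDomain Ω) (hW : IsOpen W) (hWΩ : W ⊆ Ω)
    (hf : ContDiffOn ℝ 2 f (closure Ω)) : MemH2 W f := by
  have hWb := hΩ.isBounded.subset hWΩ
  have hfW : ContDiffOn ℝ 2 f W := hf.mono (hWΩ.trans subset_closure)
  obtain ⟨K₀, hK₀⟩ := hΩ.isCompact_closure.exists_bound_of_continuousOn hf.continuousOn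
  obtain ⟨K₁, hK₁⟩ := hΩ.exists_fderivWithin_bound (hf.of_le (by norm_num))
  obtain ⟨K₂, hK₂⟩ := hΩ.exists_fderivWithin_bound
    (hf.fderivWithin (m := 1) hΩ.uniqueDiffOn_closure (by norm_num))
  set K := max K₀ (max K₁ K₂) with hK
  have h1 : ∀ x ∈ W, ‖fderiv ℝ f x‖ ≤ K := fun x hx => by
    rw [← fderivWithin_closure_eq_fderiv hΩ.isOpen (hWΩ hx)]
    exact (hK₁ x (subset_closure (hWΩ hx))).trans
      ((le_max_left _ _).trans (le_max_right _ _))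
  have h2 : ∀ x ∈ W, ‖fderiv ℝ (fderiv ℝ f) x‖ ≤ K := fun x hx => by
    have h3 : fderiv ℝ f =ᶠ[𝓝 x] fderivWithin ℝ f (closure Ω) := by
      filter_upwards [hΩ.isOpen.mem_nhds (hWΩ hx)] with y hy
      exact (fderivWithin_closure_eq_fderiv hΩ.isOpen hy).symm
    rw [h3.fderiv_eq, ← fderivWithin_closure_eq_fderiv hΩ.isOpen (hWΩ hx)]
    exact (hK₂ x (subset_closure (hWΩ hx))).trans
      ((le_max_right _ _).trans (le_max_right _ _))
  have hf1 : ContDiffOn ℝ 1 f W := hfW.of_le (by norm_num)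
  refine ⟨memH1_of_contDiffOn hW hWb hf1
    (fun x hx => (hK₀ x (subset_closure (hWΩ hx))).trans (le_max_left _ _)) h1, fun i => ?_⟩
  have hfd : ContDiffOn ℝ 1 (fderiv ℝ f) W := hfW.fderiv_of_isOpen hW (by norm_num)
  have h4 : MemH1 W (fun x => fderiv ℝ f x (stdVec i)) := by
    refine memH1_of_contDiffOn hW hWb (K := K) (hfd.clm_apply contDiffOn_const)
      (fun x hx => ?_) (fun x hx => ?_)
    · refine ((fderiv ℝ f x).le_opNorm _).trans ?_
      simpa using h1 x hx
    · have h5 := (hfd.contDiffAt (hW.mem_nhds hx)).differentiableAt (by simp)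
      rw [fderiv_clm_apply h5 (differentiableAt_const _)]
      refine ContinuousLinearMap.opNorm_le_bound _ ((norm_nonneg (fderiv ℝ f x)).trans (h1 x hx)) fun v => ?_
      simp only [fderiv_fun_const, Pi.zero_apply, ContinuousLinearMap.comp_zero, zero_add,
        ContinuousLinearMap.flip_apply]
      calc ‖fderiv ℝ (fderiv ℝ f) x v (stdVec i)‖
          ≤ ‖fderiv ℝ (fderiv ℝ f) x v‖ * ‖(stdVec i : EuclideanSpace ℝ (Fin n))‖ :=
            ContinuousLinearMap.le_opNorm _ _
        _ = ‖fderiv ℝ (fderiv ℝ f) x v‖ := by simp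
        _ ≤ ‖fderiv ℝ (fderiv ℝ f) x‖ * ‖v‖ := ContinuousLinearMap.le_opNorm _ _
        _ ≤ K * ‖v‖ := by gcongr; exact h2 x hx
  have h6 := hasWeakPartial_fderiv hW hf1 i
  exact h4.congr hW (h6.ae_eq hW (hasWeakPartial_weakPartial ⟨_, h6⟩))

end RobinInverse

/-! ### Mollification estimates -/

namespace RobinInverse

open Metric Filter Topology
open scoped NNReal Convolution

variable {n : ℕ} {ρ : ℝ → ℝ} {α : ℝ}

/-- The norm is not smooth at the origin, but `ρ` vanishes near `0`, so the kernel is locally zero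
there. -/
theorem IsMollifierProfile.contDiff_kernel (hρ : IsMollifierProfile n ρ) :
    ContDiff ℝ ∞ fun z : EuclideanSpace ℝ (Fin n) => scaledKernel n ρ α ‖z‖ := by
  rw [contDiff_iff_contDiffAt]
  intro z
  by_cases hz : z = 0
  · have h0 : (0 : ℝ) ∉ tsupport ρ := fun h => lt_irrefl _ (hρ.support h).1
    have h1 : ρ =ᶠ[𝓝 0] 0 := notMem_tsupport_iff_eventuallyEq.1 h0
    have h2 : Tendsto (fun z : EuclideanSpace ℝ (Fin n) => ‖z‖ / α) (𝓝 z) (𝓝 0) := by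
      have : Continuous fun z : EuclideanSpace ℝ (Fin n) => ‖z‖ / α := by fun_prop
      simpa [hz] using this.tendsto z
    refine (contDiffAt_const (c := (0 : ℝ))).congr_of_eventuallyEq ?_
    filter_upwards [h2.eventually h1] with y hy
    simp [scaledKernel, hy]
  · unfold scaledKernel
    exact contDiffAt_const.mul
      (hρ.smooth.contDiffAt.comp z (((contDiffAt_norm ℝ hz)).div_const α))

theorem IsMollifierProfile.kernel_eq_zero (hρ : IsMollifierProfile n ρ) (hα : 0 < α) {t : ℝ}
    (ht : α ≤ t) : scaledKernel n ρ α t = 0 := by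
  have : t / α ∉ tsupport ρ := fun h => by
    have := (hρ.support h).2
    rw [div_lt_one hα] at this
    linarith
  rw [scaledKernel, image_eq_zero_of_notMem_tsupport this, mul_zero]

theorem IsMollifierProfile.hasCompactSupport_kernel (hρ : IsMollifierProfile n ρ) (hα : 0 < α) :
    HasCompactSupport fun z : EuclideanSpace ℝ (Fin n) => scaledKernel n ρ α ‖z‖ := by
  refine HasCompactSupport.intro (isCompact_closedBall 0 α) fun z hz => ?_
  rw [mem_closedBall_zero_iff, not_le] at hz
  exact hρ.kernel_eq_zero hα hz.le

theorem IsMollifierProfile.kernel_nonneg (hρ : IsMollifierProfile n ρ) (hα : 0 < α) (t : ℝ) :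
    0 ≤ scaledKernel n ρ α t :=
  mul_nonneg (by positivity) (hρ.nonneg _)

theorem IsMollifierProfile.integral_kernel (hρ : IsMollifierProfile n ρ) (hα : 0 < α) :
    ∫ z : EuclideanSpace ℝ (Fin n), scaledKernel n ρ α ‖z‖ = 1 := by
  have h1 : ∀ z : EuclideanSpace ℝ (Fin n), scaledKernel n ρ α ‖z‖ =
      1 / α ^ n * (fun z : EuclideanSpace ℝ (Fin n) => ρ ‖z‖) (α⁻¹ • z) := by
    intro z
    simp only [scaledKernel, norm_smul, norm_inv, Real.norm_eq_abs, abs_of_pos hα]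
    rw [div_eq_inv_mul ‖z‖ α]
  simp_rw [h1]
  have h2 := Measure.integral_comp_inv_smul_of_nonneg volume
    (fun z : EuclideanSpace ℝ (Fin n) => ρ ‖z‖) hα.le
  simp only [hρ.mass] at h2
  rw [integral_const_mul, h2]
  simp [hα.ne']

theorem IsMollifierProfile.exists_bound (hρ : IsMollifierProfile n ρ) :
    ∃ B : ℝ, 0 ≤ B ∧ ∀ α > 0, ∀ t, scaledKernel n ρ α t ≤ B / α ^ n := by
  have hc : HasCompactSupport ρ := isCompact_Icc.of_isClosed_subset (isClosed_tsupport ρ)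
    (hρ.support.trans Ioo_subset_Icc_self)
  obtain ⟨B, hB⟩ := hρ.smooth.continuous.bounded_above_of_compact_support hc
  refine ⟨B, (norm_nonneg _).trans (hB 0), fun α hα t => ?_⟩
  rw [scaledKernel, one_div, inv_mul_eq_div]
  gcongr
  exact (le_abs_self _).trans (hB _)

/-- Mollification of `f` with the kernel `ρ_α(|x|)`. -/
noncomputable def convKernel (ρ : ℝ → ℝ) (α : ℝ) (f : EuclideanSpace ℝ (Fin n) → ℝ)
    (x : EuclideanSpace ℝ (Fin n)) : ℝ :=
  ∫ y, scaledKernel n ρ α ‖x - y‖ * f y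

theorem convKernel_eq_convolution (f : EuclideanSpace ℝ (Fin n) → ℝ) :
    convKernel ρ α f = (f ⋆[ContinuousLinearMap.mul ℝ ℝ, volume]
      fun z : EuclideanSpace ℝ (Fin n) => scaledKernel n ρ α ‖z‖) := by
  ext x
  rw [convKernel, convolution_def]
  simp [mul_comm]

variable {f g : EuclideanSpace ℝ (Fin n) → ℝ}

theorem contDiff_convKernel (hρ : IsMollifierProfile n ρ) (hα : 0 < α)
    (hf : LocallyIntegrable f) : ContDiff ℝ ∞ (convKernel ρ α f) := by
  rw [convKernel_eq_convolution]
  exact (hρ.hasCompactSupport_kernel hα).contDiff_convolution_right _ hf (hρ.contDiff_kernel)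

/-- Mollification commutes with weak derivatives. -/
theorem fderiv_convKernel_apply (hρ : IsMollifierProfile n ρ) (hα : 0 < α) {i : Fin n}
    (h : HasWeakPartial univ i f g) (x : EuclideanSpace ℝ (Fin n)) :
    fderiv ℝ (convKernel ρ α f) x (stdVec i) = convKernel ρ α g x := by
  set k : EuclideanSpace ℝ (Fin n) → ℝ := fun z => scaledKernel n ρ α ‖z‖ with hk
  have hkc : ContDiff ℝ ∞ k := hρ.contDiff_kernel
  have hks : HasCompactSupport k := hρ.hasCompactSupport_kernel hα
  have hf : LocallyIntegrable f := locallyIntegrableOn_univ.1 h.locInt_fun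
  have h1 := hks.hasFDerivAt_convolution_right (ContinuousLinearMap.mul ℝ ℝ) hf
    (hkc.of_le (by simp)) x
  rw [convKernel_eq_convolution, h1.fderiv, convolution_precompR_apply _ hf (hks.fderiv ℝ)
    (hkc.continuous_fderiv (by simp)), convolution_def]
  have hrefl : ContDiff ℝ ∞ fun y : EuclideanSpace ℝ (Fin n) => x - y := by fun_prop
  have hφ : ContDiff ℝ ∞ fun y => k (x - y) := hkc.comp hrefl
  have hφs : HasCompactSupport fun y => k (x - y) :=
    hks.comp_homeomorph (Homeomorph.subLeft x)
  have h2 := h.integral_eq _ hφ hφs (subset_univ _)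
  rw [setIntegral_univ, setIntegral_univ] at h2
  have h3 : ∀ y, fderiv ℝ (fun y => k (x - y)) y (stdVec i) = -fderiv ℝ k (x - y) (stdVec i) := by
    intro y
    have h4 : HasFDerivAt (fun y : EuclideanSpace ℝ (Fin n) => x - y)
        (-ContinuousLinearMap.id ℝ _) y := (hasFDerivAt_id y).const_sub x
    have h5 := ((hkc.differentiable (by simp) (x - y)).hasFDerivAt.comp y h4).fderiv
    simp only [Function.comp_def] at h5
    rw [h5]
    simp
  simp_rw [h3, mul_neg, integral_neg, neg_inj] at h2
  simp only [ContinuousLinearMap.mul_apply']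
  rw [h2, convKernel]
  simp_rw [mul_comm, hk]

theorem IsMollifierProfile.continuous_kernel (hρ : IsMollifierProfile n ρ) :
    Continuous fun z : EuclideanSpace ℝ (Fin n) => scaledKernel n ρ α ‖z‖ :=
  (hρ.contDiff_kernel).continuous

theorem IsMollifierProfile.integrable_kernel (hρ : IsMollifierProfile n ρ) (hα : 0 < α) :
    Integrable fun z : EuclideanSpace ℝ (Fin n) => scaledKernel n ρ α ‖z‖ :=
  (hρ.continuous_kernel).integrable_of_hasCompactSupport (hρ.hasCompactSupport_kernel hα)

theorem IsMollifierProfile.integrable_kernel_mul (hρ : IsMollifierProfile n ρ) (hα : 0 < α)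
    (hf : LocallyIntegrable f) (x : EuclideanSpace ℝ (Fin n)) :
    Integrable fun y => scaledKernel n ρ α ‖x - y‖ * f y := by
  have h1 : Continuous fun y : EuclideanSpace ℝ (Fin n) => scaledKernel n ρ α ‖x - y‖ :=
    (hρ.continuous_kernel).comp (continuous_const.sub continuous_id)
  have h2 : HasCompactSupport fun y : EuclideanSpace ℝ (Fin n) => scaledKernel n ρ α ‖x - y‖ :=
    (hρ.hasCompactSupport_kernel hα).comp_homeomorph (Homeomorph.subLeft x)
  exact hf.integrable_smul_left_of_hasCompactSupport h1 h2

theorem IsMollifierProfile.lintegral_kernel (hρ : IsMollifierProfile n ρ) (hα : 0 < α)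
    (x : EuclideanSpace ℝ (Fin n)) :
    ∫⁻ y, ENNReal.ofReal (scaledKernel n ρ α ‖x - y‖) = 1 := by
  rw [lintegral_sub_left_eq_self (fun z : EuclideanSpace ℝ (Fin n) =>
    ENNReal.ofReal (scaledKernel n ρ α ‖z‖)) x,
    ← ofReal_integral_eq_lintegral_ofReal (hρ.integrable_kernel hα)
      (Eventually.of_forall fun z => hρ.kernel_nonneg hα _), hρ.integral_kernel hα,
    ENNReal.ofReal_one]

/-- Jensen's inequality for the mollification. -/
theorem enorm_convKernel_sq_le (hρ : IsMollifierProfile n ρ) (hα : 0 < α)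
    (hf : AEStronglyMeasurable f) (x : EuclideanSpace ℝ (Fin n)) :
    ‖convKernel ρ α f x‖ₑ ^ 2 ≤
      ∫⁻ y, ENNReal.ofReal (scaledKernel n ρ α ‖x - y‖) * ‖f y‖ₑ ^ 2 := by
  set κ : EuclideanSpace ℝ (Fin n) → ℝ≥0∞ :=
    fun y => ENNReal.ofReal (scaledKernel n ρ α ‖x - y‖) with hκ
  have hκm : Measurable κ := ENNReal.measurable_ofReal.comp
    ((hρ.continuous_kernel).comp (continuous_const.sub continuous_id)).measurable
  -- Writing the kernel as a product of square roots prepares Cauchy–Schwarz, in which one factor is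
  -- the total mass `1`.
  have h1 : ‖convKernel ρ α f x‖ₑ ≤ ∫⁻ y, κ y ^ (1 / 2 : ℝ) * (κ y ^ (1 / 2 : ℝ) * ‖f y‖ₑ) := by
    refine (enorm_integral_le_lintegral_enorm _).trans_eq (lintegral_congr fun y => ?_)
    rw [enorm_mul, ← mul_assoc, ← ENNReal.rpow_add_of_nonneg _ _ (by norm_num) (by norm_num),
      Real.enorm_of_nonneg (hρ.kernel_nonneg hα _)]
    norm_num [hκ]
  have h2 := ENNReal.lintegral_mul_le_Lp_mul_Lq volume Real.HolderConjugate.two_two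
    (f := fun y => κ y ^ (1 / 2 : ℝ)) (g := fun y => κ y ^ (1 / 2 : ℝ) * ‖f y‖ₑ)
    (hκm.pow_const _).aemeasurable ((hκm.pow_const _).aemeasurable.mul hf.enorm)
  have h3 : ∀ y, (κ y ^ (1 / 2 : ℝ)) ^ (2 : ℝ) = κ y := fun y => by
    rw [← ENNReal.rpow_mul]; norm_num
  simp only [Pi.mul_apply, ENNReal.mul_rpow_of_nonneg _ _ (by norm_num : (0 : ℝ) ≤ 2), h3] at h2
  rw [show ∫⁻ y, κ y = 1 from hρ.lintegral_kernel hα x, ENNReal.one_rpow, one_mul] at h2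
  calc ‖convKernel ρ α f x‖ₑ ^ 2
      ≤ ((∫⁻ y, κ y * ‖f y‖ₑ ^ (2 : ℝ)) ^ (1 / 2 : ℝ)) ^ 2 := by gcongr; exact h1.trans h2
    _ = ∫⁻ y, κ y * ‖f y‖ₑ ^ 2 := by
      rw [← ENNReal.rpow_natCast, ← ENNReal.rpow_mul]
      norm_num

theorem eLpNorm_two_sq (f : EuclideanSpace ℝ (Fin n) → ℝ) (μ : Measure (EuclideanSpace ℝ (Fin n))) :
    eLpNorm f 2 μ ^ 2 = ∫⁻ x, ‖f x‖ₑ ^ 2 ∂μ := by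
  have := eLpNorm_nnreal_pow_eq_lintegral (f := f) (p := 2) (μ := μ) (by norm_num)
  simpa using this

/-- Jensen with the kernel replaced by its supremum. Being pointwise, it applies on the null set
`∂Ω`; the price is the factor `α⁻ⁿ` that amplifies the noise. -/
theorem enorm_convKernel_sq_le_eLpNorm (hρ : IsMollifierProfile n ρ) {B : ℝ}
    (hB : ∀ α > 0, ∀ t, scaledKernel n ρ α t ≤ B / α ^ n) (hα : 0 < α)
    (hf : AEStronglyMeasurable f) (x : EuclideanSpace ℝ (Fin n)) :
    ‖convKernel ρ α f x‖ₑ ^ 2 ≤ ENNReal.ofReal (B / α ^ n) * eLpNorm f 2 volume ^ 2 := by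
  refine (enorm_convKernel_sq_le hρ hα hf x).trans ?_
  rw [eLpNorm_two_sq, ← lintegral_const_mul' _ _ ENNReal.ofReal_ne_top]
  gcongr with y
  exact hB α hα _

/-- Jensen and Tonelli: the kernel has unit mass in either variable, so mollification is an `L²`
contraction, with a bound uniform in `α`. -/
theorem lintegral_enorm_convKernel_sq_le (hρ : IsMollifierProfile n ρ) (hα : 0 < α)
    (hf : AEStronglyMeasurable f) :
    ∫⁻ x, ‖convKernel ρ α f x‖ₑ ^ 2 ≤ eLpNorm f 2 volume ^ 2 := by
  have hκm : Measurable fun p : EuclideanSpace ℝ (Fin n) × EuclideanSpace ℝ (Fin n) =>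
      ENNReal.ofReal (scaledKernel n ρ α ‖p.1 - p.2‖) := ENNReal.measurable_ofReal.comp
    ((hρ.continuous_kernel).comp (continuous_fst.sub continuous_snd)).measurable
  calc ∫⁻ x, ‖convKernel ρ α f x‖ₑ ^ 2
      ≤ ∫⁻ x, ∫⁻ y, ENNReal.ofReal (scaledKernel n ρ α ‖x - y‖) * ‖f y‖ₑ ^ 2 :=
        lintegral_mono fun x => enorm_convKernel_sq_le hρ hα hf x
    _ = ∫⁻ y, ∫⁻ x, ENNReal.ofReal (scaledKernel n ρ α ‖x - y‖) * ‖f y‖ₑ ^ 2 := by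
        refine lintegral_lintegral_swap (hκm.aemeasurable.mul ?_)
        exact (hf.comp_snd.enorm).pow_const 2
    _ = ∫⁻ y, ‖f y‖ₑ ^ 2 := by
        refine lintegral_congr fun y => ?_
        rw [lintegral_mul_const' _ _ (by simp)]
        simp_rw [norm_sub_rev _ y]
        rw [hρ.lintegral_kernel hα y, one_mul]
    _ = _ := (eLpNorm_two_sq f volume).symm

/-- If `f` is within `m` of `c` on the ball of radius `α` about `x`, so is the mollification at
`x`. -/
theorem abs_convKernel_sub_le (hρ : IsMollifierProfile n ρ) (hα : 0 < α)
    (hf : LocallyIntegrable f) {x : EuclideanSpace ℝ (Fin n)} {c m : ℝ}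
    (h : ∀ᵐ y, y ∈ ball x α → |f y - c| ≤ m) : |convKernel ρ α f x - c| ≤ m := by
  have hk1 : ∫ y, scaledKernel n ρ α ‖x - y‖ = 1 := by
    rw [integral_sub_left_eq_self (fun z : EuclideanSpace ℝ (Fin n) => scaledKernel n ρ α ‖z‖)
      volume x, hρ.integral_kernel hα]
  have hki : Integrable fun y => scaledKernel n ρ α ‖x - y‖ :=
    (hρ.integrable_kernel hα).comp_sub_left x
  have h1 : convKernel ρ α f x - c = ∫ y, scaledKernel n ρ α ‖x - y‖ * (f y - c) := by
    simp_rw [mul_sub]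
    rw [integral_sub (hρ.integrable_kernel_mul hα hf x) (hki.mul_const c), integral_mul_const, hk1,
      one_mul, convKernel]
  rw [h1, ← Real.norm_eq_abs]
  calc ‖∫ y, scaledKernel n ρ α ‖x - y‖ * (f y - c)‖
      ≤ ∫ y, scaledKernel n ρ α ‖x - y‖ * m := by
        refine norm_integral_le_of_norm_le (hki.mul_const m) ?_
        filter_upwards [h] with y hy
        rw [norm_mul, Real.norm_of_nonneg (hρ.kernel_nonneg hα _), Real.norm_eq_abs]
        by_cases hyb : y ∈ ball x α
        · exact mul_le_mul_of_nonneg_left (hy hyb) (hρ.kernel_nonneg hα _)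
        · rw [mem_ball, dist_eq_norm, norm_sub_rev, not_lt] at hyb
          rw [hρ.kernel_eq_zero hα hyb, zero_mul, zero_mul]
    _ = m := by rw [integral_mul_const, hk1, one_mul]

theorem convKernel_sub (hρ : IsMollifierProfile n ρ) (hα : 0 < α)
    (hf : LocallyIntegrable f) (hg : LocallyIntegrable g) :
    convKernel ρ α (fun x => f x - g x) = fun x => convKernel ρ α f x - convKernel ρ α g x := by
  ext x
  simp only [convKernel, mul_sub]
  exact integral_sub (hρ.integrable_kernel_mul hα hf x) (hρ.integrable_kernel_mul hα hg x)

theorem convKernel_congr_ae (hfg : f =ᵐ[volume] g) : convKernel ρ α f = convKernel ρ α g := by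
  ext x
  exact integral_congr_ae (EventuallyEq.rfl.mul hfg)

end RobinInverse

/-! ### Local approximation of the boundary gradient -/

namespace RobinInverse

open Metric Filter Topology
open scoped NNReal

variable {n : ℕ}

theorem enorm_sq_eq_ofReal (x : ℝ) : ‖x‖ₑ ^ 2 = ENNReal.ofReal (x ^ 2) := by
  rw [← ofReal_norm, ← ENNReal.ofReal_pow (norm_nonneg _), Real.norm_eq_abs, sq_abs]

theorem enorm_add_sq_le (a b : ℝ) : ‖a + b‖ₑ ^ 2 ≤ 2 * ‖a‖ₑ ^ 2 + 2 * ‖b‖ₑ ^ 2 := by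
  simp_rw [enorm_sq_eq_ofReal]
  rw [← ENNReal.ofReal_ofNat 2, ← ENNReal.ofReal_mul (by norm_num),
    ← ENNReal.ofReal_mul (by norm_num), ← ENNReal.ofReal_add (by positivity) (by positivity)]
  exact ENNReal.ofReal_le_ofReal (by nlinarith [sq_nonneg (a - b)])

theorem setLIntegral_sq_le {f : ℝ → ℝ≥0∞} {A : Set ℝ} (hf : Measurable f) :
    (∫⁻ t in A, f t) ^ 2 ≤ volume A * ∫⁻ t in A, f t ^ 2 := by
  have h := ENNReal.lintegral_mul_le_Lp_mul_Lq (volume.restrict A) Real.HolderConjugate.two_two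
    (f := fun _ => 1) (g := f) aemeasurable_const hf.aemeasurable
  simp only [Pi.mul_apply, one_mul, one_pow, lintegral_one,
    Measure.restrict_apply_univ, ENNReal.rpow_two] at h
  calc (∫⁻ t in A, f t) ^ 2
      ≤ (volume A ^ (1 / 2 : ℝ) * (∫⁻ t in A, f t ^ 2) ^ (1 / 2 : ℝ)) ^ 2 := by gcongr
    _ = volume A * ∫⁻ t in A, f t ^ 2 := by
      rw [mul_pow, ← ENNReal.rpow_natCast, ← ENNReal.rpow_natCast, ← ENNReal.rpow_mul,
        ← ENNReal.rpow_mul]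
      norm_num

/-- The increment of a `C¹` function over a segment is controlled by its derivative on the line. -/
theorem enorm_sub_translate_sq_le {G : EuclideanSpace ℝ (Fin n) → ℝ} (hG : ContDiff ℝ 1 G)
    (x e : EuclideanSpace ℝ (Fin n)) {s : ℝ} (hs : 0 ≤ s) :
    ‖G x - G (x - s • e)‖ₑ ^ 2 ≤
      ENNReal.ofReal s * ∫⁻ t : ℝ, ‖fderiv ℝ G (x - t • e) e‖ₑ ^ 2 := by
  have hc : Continuous fun t : ℝ => fderiv ℝ G (x - t • e) e :=
    ((hG.continuous_fderiv (by simp)).comp (by fun_prop)).clm_apply continuous_const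
  have hd : ∀ t : ℝ, HasDerivAt (fun t : ℝ => -G (x - t • e)) (fderiv ℝ G (x - t • e) e) t := by
    intro t
    have h1 : HasDerivAt (fun t : ℝ => x - t • e) (-e) t := by
      simpa using ((hasDerivAt_id t).smul_const e).const_sub x
    have h2 := ((hG.differentiable (by simp) (x - t • e)).hasFDerivAt.comp_hasDerivAt t h1).neg
    exact h2.congr_deriv (by simp)
  have h1 : G x - G (x - s • e) = ∫ t in Ioc 0 s, fderiv ℝ G (x - t • e) e := by
    rw [← intervalIntegral.integral_of_le hs,
      intervalIntegral.integral_eq_sub_of_hasDerivAt (fun t _ => hd t)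
        (hc.intervalIntegrable 0 s)]
    simp
    ring
  have h2 : ‖G x - G (x - s • e)‖ₑ ≤ ∫⁻ t in Ioc 0 s, ‖fderiv ℝ G (x - t • e) e‖ₑ := by
    rw [h1]; exact enorm_integral_le_lintegral_enorm _
  calc ‖G x - G (x - s • e)‖ₑ ^ 2 ≤ (∫⁻ t in Ioc 0 s, ‖fderiv ℝ G (x - t • e) e‖ₑ) ^ 2 := by
        gcongr
    _ ≤ volume (Ioc 0 s) * ∫⁻ t in Ioc 0 s, ‖fderiv ℝ G (x - t • e) e‖ₑ ^ 2 :=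
        setLIntegral_sq_le hc.enorm.measurable
    _ ≤ _ := by
        rw [Real.volume_Ioc, sub_zero]
        gcongr
        exact Measure.restrict_le_self

variable {Ω : Set (EuclideanSpace ℝ (Fin n))}

/-- In a cone with vertex `x` inside `Ω`, the gradient of a `C²(Ω̄)` function is Lipschitz at `x`. -/
theorem norm_fderivWithin_sub_le_of_cone (hΩ : IsBoundedSmoothDomain Ω)
    {u : EuclideanSpace ℝ (Fin n) → ℝ} (hu : ContDiffOn ℝ 2 u (closure Ω)) {K r L s : ℝ}
    (hK : ∀ x ∈ closure Ω, ‖fderivWithin ℝ (fderivWithin ℝ u (closure Ω)) (closure Ω) x‖ ≤ K)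
    {x e y : EuclideanSpace ℝ (Fin n)} (hx : x ∈ closure Ω)
    (hcone : ∀ t, 0 < t → t < r → ball (x - t • e) (t / L) ⊆ Ω) (hs : 0 < s) (hsr : s < r)
    (hy : y ∈ ball (x - s • e) (s / L)) :
    ‖fderivWithin ℝ u (closure Ω) y - fderivWithin ℝ u (closure Ω) x‖ ≤ K * ‖y - x‖ := by
  have hseg : segment ℝ x y ⊆ closure Ω := by
    rw [segment_eq_image']
    rintro _ ⟨τ, ⟨hτ0, hτ1⟩, rfl⟩
    rcases hτ0.eq_or_lt with rfl | hτ
    · simpa using hx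
    · apply subset_closure
      apply hcone (τ * s) (by positivity) (lt_of_le_of_lt (by nlinarith) hsr)
      rw [mem_ball, dist_eq_norm] at hy ⊢
      have : x + τ • (y - x) - (x - (τ * s) • e) = τ • (y - (x - s • e)) := by module
      simp only [this, norm_smul, Real.norm_eq_abs, abs_of_pos hτ]
      rw [mul_div_assoc]
      gcongr
  have hd : DifferentiableOn ℝ (fderivWithin ℝ u (closure Ω)) (closure Ω) :=
    (hu.fderivWithin (m := 1) hΩ.uniqueDiffOn_closure (by norm_num)).differentiableOn (by simp)
  exact Convex.norm_image_sub_le_of_norm_hasFDerivWithin_le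
    (fun z hz => (hd z (hseg hz)).hasFDerivWithinAt.mono hseg)
    (fun z hz => hK z (hseg hz)) (convex_segment x y)
    (left_mem_segment ℝ x y) (right_mem_segment ℝ x y)

theorem mem_interior_boundaryLayer {ε s : ℝ} {x z : EuclideanSpace ℝ (Fin n)}
    (hx : x ∈ frontier Ω) {a : EuclideanSpace ℝ (Fin n)} (hsub : ball a s ⊆ Ω) (hz : z ∈ ball a s)
    (hε : dist a x + s ≤ ε) : z ∈ interior (boundaryLayer Ω ε) := by
  refine mem_interior.2 ⟨ball a s, fun w hw => ⟨hsub hw, ?_⟩, isOpen_ball, hz⟩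
  refine (infDist_le_dist_of_mem hx).trans ((dist_triangle w a x).trans ?_)
  rw [mem_ball] at hw
  linarith

/-- Weak derivatives are local: where the extension agrees with `u`, uniqueness identifies its weak
derivative with the classical one. -/
theorem weakPartial_univ_ae_eq {W : Set (EuclideanSpace ℝ (Fin n))} (hW : IsOpen W)
    {F u : EuclideanSpace ℝ (Fin n) → ℝ} (hF : MemH1 univ F) (hFu : F =ᵐ[volume.restrict W] u)
    (hu : ContDiffOn ℝ 1 u W) (i : Fin n) :
    weakPartial univ i F =ᵐ[volume.restrict W] fun x => fderiv ℝ u x (stdVec i) :=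
  ((hF.hasWeakPartial i).restrict.congr hFu EventuallyEq.rfl).ae_eq hW
    (hasWeakPartial_fderiv hW hu i)

theorem MemH1.locallyIntegrable {F : EuclideanSpace ℝ (Fin n) → ℝ} (hF : MemH1 univ F) :
    LocallyIntegrable F :=
  (by simpa using hF.1 : MemLp F 2 volume).locallyIntegrable (by norm_num)

theorem MemH1.memLp_weakPartial {F : EuclideanSpace ℝ (Fin n) → ℝ} (hF : MemH1 univ F)
    (i : Fin n) : MemLp (weakPartial univ i F) 2 volume := by
  simpa using (hF.2 i).2

/-- Local form of the approximation property of the mollified gradient on the boundary. -/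
theorem exists_local_approx (hΩ : IsBoundedSmoothDomain Ω) {ε : ℝ} (hε : 0 < ε)
    {u F : EuclideanSpace ℝ (Fin n) → ℝ} (hu : ContDiffOn ℝ 2 u (closure Ω))
    (hF : MemH2 univ F) (hFu : F =ᵐ[volume.restrict (interior (boundaryLayer Ω ε))] u)
    {ρ : ℝ → ℝ} (hρ : IsMollifierProfile n ρ) (i : Fin n) {x₀ : EuclideanSpace ℝ (Fin n)}
    (hx₀ : x₀ ∈ frontier Ω) :
    ∃ r > 0, ∃ (A : ℝ≥0) (α₁ : ℝ), 0 < α₁ ∧ α₁ ≤ 1 ∧ ∀ α, 0 < α → α ≤ α₁ →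
      ∫⁻ x in frontier Ω ∩ ball x₀ r, ‖convKernel ρ α (weakPartial univ i F) x -
        fderivWithin ℝ u (closure Ω) x (stdVec i)‖ₑ ^ 2
          ∂(Measure.euclideanHausdorffMeasure (n - 1)) ≤ A * ENNReal.ofReal α := by
  obtain ⟨V, φ, hd⟩ := hΩ.smooth_boundary x₀ hx₀
  obtain ⟨j, c, r, L, hc, hr, hL, hcone, hLip⟩ := hd.exists_cone hΩ.isOpen
  have hL0 : 0 < L := by linarith
  set S := frontier Ω ∩ ball x₀ r with hS
  have hSm : MeasurableSet S := isClosed_frontier.measurableSet.inter measurableSet_ball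
  obtain ⟨C, hC⟩ := exists_lintegral_line_le (S := S) hc hL0.le hLip
  obtain ⟨K, hK⟩ := hΩ.exists_fderivWithin_bound
    (hu.fderivWithin (m := 1) hΩ.uniqueDiffOn_closure (by norm_num))
  have hK0 : 0 ≤ K := (norm_nonneg _).trans (hK x₀ (frontier_subset_closure hx₀))
  set μ : Measure (EuclideanSpace ℝ (Fin n)) := Measure.euclideanHausdorffMeasure (n - 1) with hμ
  have hμS : μ S < ⊤ := by
    have := surfaceMeasure_lt_top hΩ
    rw [surfaceMeasure, Measure.restrict_apply_univ] at this
    exact (measure_mono inter_subset_left).trans_lt this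
  set e : EuclideanSpace ℝ (Fin n) := c • stdVec j with he
  have hen : ‖e‖ = 1 := by simp [he, norm_smul, hc]
  set f := weakPartial univ i F with hf
  have hf1 : MemH1 univ f := hF.2 i
  set N := eLpNorm (weakPartial univ j f) 2 volume with hN
  have hNt : N < ⊤ := (hf1.memLp_weakPartial j).2
  set A : ℝ≥0∞ := 2 * (ENNReal.ofReal L * (C * N ^ 2)) +
    2 * (ENNReal.ofReal ((K * (L + 1)) ^ 2) * μ S) with hA
  have hAt : A ≠ ⊤ := by
    simp only [hA]
    finiteness
  -- The three bounds on `α` respectively turn `α²` into at most `α`, keep the step `L α` within the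
  -- cone, and keep the ball of radius `α` about the shifted point inside the layer of width `ε`.
  refine ⟨r, hr, A.toNNReal, min 1 (min (r / (2 * L)) (ε / (L + 1))), by positivity,
    min_le_left _ _, fun α hα hα₁ => ?_⟩
  have hα1 : α ≤ 1 := hα₁.trans (min_le_left _ _)
  have hαr : L * α < r := by
    have h1 : α ≤ r / (2 * L) := hα₁.trans ((min_le_right _ _).trans (min_le_left _ _))
    rw [le_div_iff₀ (by positivity)] at h1
    nlinarith
  have hαε : L * α + α ≤ ε := by
    have h1 : α ≤ ε / (L + 1) := hα₁.trans ((min_le_right _ _).trans (min_le_right _ _))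
    rw [le_div_iff₀ (by positivity)] at h1
    linarith
  rw [ENNReal.coe_toNNReal hAt]
  set G := convKernel ρ α f with hG
  have hGc : ContDiff ℝ 1 G :=
    (contDiff_convKernel hρ hα hf1.locallyIntegrable).of_le (by simp)
  -- The smallest shift for which the ball provided by the cone, of radius `s / L`, contains the
  -- support of the kernel.
  set s := L * α with hs
  have hs0 : 0 < s := by positivity
  have hsL : s / L = α := by rw [hs]; field_simp
  set W := interior (boundaryLayer Ω ε) with hW
  have hWΩ : W ⊆ Ω := interior_subset.trans fun x hx => hx.1
  have huW : ContDiffOn ℝ 1 u W := (hu.mono (hWΩ.trans subset_closure)).of_le (by norm_num)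
  have hfW := weakPartial_univ_ae_eq isOpen_interior hF.1 hFu huW i
  have hpt : ∀ x ∈ S, |G (x - s • e) - fderivWithin ℝ u (closure Ω) x (stdVec i)| ≤
      K * (L + 1) * α := by
    intro x hx
    refine abs_convKernel_sub_le hρ hα hf1.locallyIntegrable ?_
    have hsub := hcone x hx s hs0 hαr
    rw [hsL] at hsub
    have hdist : dist (x - s • e) x = s := by
      rw [dist_eq_norm, sub_sub_cancel_left, norm_neg, norm_smul, hen, mul_one,
        Real.norm_of_nonneg hs0.le]
    filter_upwards [(ae_restrict_iff' isOpen_interior.measurableSet).1 hfW] with y hy hyb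
    have hyW : y ∈ W := mem_interior_boundaryLayer hx.1 hsub hyb
      (by rw [hdist]; exact hαε)
    rw [hf, hy hyW, ← fderivWithin_closure_eq_fderiv hΩ.isOpen (hWΩ hyW)]
    have h1 := norm_fderivWithin_sub_le_of_cone hΩ hu hK (frontier_subset_closure hx.1)
      (hcone x hx) hs0 hαr (by rwa [hsL])
    have h2 : ‖y - x‖ ≤ (L + 1) * α := by
      rw [← dist_eq_norm]
      refine (dist_triangle y (x - s • e) x).trans ?_
      rw [hdist]
      have := mem_ball.1 hyb
      linarith
    calc |fderivWithin ℝ u (closure Ω) y (stdVec i) - fderivWithin ℝ u (closure Ω) x (stdVec i)|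
        = ‖(fderivWithin ℝ u (closure Ω) y - fderivWithin ℝ u (closure Ω) x) (stdVec i)‖ := rfl
      _ ≤ ‖fderivWithin ℝ u (closure Ω) y - fderivWithin ℝ u (closure Ω) x‖ * 1 := by
        refine (ContinuousLinearMap.le_opNorm _ _).trans_eq ?_
        simp
      _ ≤ K * ((L + 1) * α) := by
        rw [mul_one]
        exact h1.trans (by gcongr)
      _ = K * (L + 1) * α := by ring
  have hder : ∀ y, ‖fderiv ℝ G y e‖ₑ ^ 2 = ‖convKernel ρ α (weakPartial univ j f) y‖ₑ ^ 2 := by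
    intro y
    rw [he, map_smul, hG, fderiv_convKernel_apply hρ hα (hf1.hasWeakPartial j), enorm_smul]
    simp [← ofReal_norm c, hc]
  have hcG2 : Continuous (convKernel ρ α (weakPartial univ j f)) :=
    (contDiff_convKernel hρ hα
      ((hf1.memLp_weakPartial j).locallyIntegrable (by norm_num))).continuous
  -- Cauchy–Schwarz on the segment yields the factor `s = L α`, the source of the rate `α^{1/2}`.
  -- The rest is bounded by the `L²` norm of a second weak derivative of `F`.
  have hI1 : ∫⁻ x in S, ‖G x - G (x - s • e)‖ₑ ^ 2 ∂μ ≤ ENNReal.ofReal s * (C * N ^ 2) := by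
    calc ∫⁻ x in S, ‖G x - G (x - s • e)‖ₑ ^ 2 ∂μ
        ≤ ∫⁻ x in S, ENNReal.ofReal s *
            (∫⁻ t : ℝ, ‖convKernel ρ α (weakPartial univ j f) (x - t • e)‖ₑ ^ 2) ∂μ := by
          refine lintegral_mono fun x => ?_
          refine (enorm_sub_translate_sq_le hGc x e hs0.le).trans_eq ?_
          simp_rw [hder]
      _ = ENNReal.ofReal s * ∫⁻ x in S,
            (∫⁻ t : ℝ, ‖convKernel ρ α (weakPartial univ j f) (x - t • e)‖ₑ ^ 2) ∂μ :=
          lintegral_const_mul' _ _ ENNReal.ofReal_ne_top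
      _ ≤ ENNReal.ofReal s * (C * ∫⁻ x, ‖convKernel ρ α (weakPartial univ j f) x‖ₑ ^ 2) := by
          gcongr
          exact hC (fun x => ‖convKernel ρ α (weakPartial univ j f) x‖ₑ ^ 2)
            (hcG2.enorm.measurable.pow_const 2)
      _ ≤ _ := by
          gcongr
          exact lintegral_enorm_convKernel_sq_le hρ hα (hf1.memLp_weakPartial j).1
  have hI2 : ∫⁻ x in S, ‖G (x - s • e) - fderivWithin ℝ u (closure Ω) x (stdVec i)‖ₑ ^ 2 ∂μ ≤
      ENNReal.ofReal ((K * (L + 1)) ^ 2) * μ S * ENNReal.ofReal α := by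
    calc _ ≤ ∫⁻ _x in S, ENNReal.ofReal ((K * (L + 1)) ^ 2) * ENNReal.ofReal α ∂μ := by
          refine setLIntegral_mono' hSm fun x hx => ?_
          rw [← ofReal_norm, ← ENNReal.ofReal_pow (norm_nonneg _),
            ← ENNReal.ofReal_mul (by positivity)]
          refine ENNReal.ofReal_le_ofReal ?_
          calc _ ≤ (K * (L + 1) * α) ^ 2 := by gcongr; exact hpt x hx
            _ = (K * (L + 1)) ^ 2 * α ^ 2 := by ring
            _ ≤ (K * (L + 1)) ^ 2 * α := by gcongr; nlinarith
      _ = _ := by rw [setLIntegral_const]; ring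
  have hm : Measurable fun x => 2 * ‖G x - G (x - s • e)‖ₑ ^ 2 := by
    have : Continuous fun x => G x - G (x - s • e) :=
      hGc.continuous.sub (hGc.continuous.comp (by fun_prop))
    exact (this.enorm.measurable.pow_const 2).const_mul 2
  calc _ ≤ ∫⁻ x in S, (2 * ‖G x - G (x - s • e)‖ₑ ^ 2 +
        2 * ‖G (x - s • e) - fderivWithin ℝ u (closure Ω) x (stdVec i)‖ₑ ^ 2) ∂μ := by
        refine lintegral_mono fun x => ?_
        refine le_trans (le_of_eq ?_) (enorm_add_sq_le _ _)
        rw [sub_add_sub_cancel]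
    _ = 2 * ∫⁻ x in S, ‖G x - G (x - s • e)‖ₑ ^ 2 ∂μ +
        2 * ∫⁻ x in S, ‖G (x - s • e) -
          fderivWithin ℝ u (closure Ω) x (stdVec i)‖ₑ ^ 2 ∂μ := by
        rw [lintegral_add_left hm, lintegral_const_mul' _ _ (by simp),
          lintegral_const_mul' _ _ (by simp)]
    _ ≤ 2 * (ENNReal.ofReal s * (C * N ^ 2)) +
        2 * (ENNReal.ofReal ((K * (L + 1)) ^ 2) * μ S * ENNReal.ofReal α) := by gcongr
    _ = A * ENNReal.ofReal α := by
        rw [hs, ENNReal.ofReal_mul hL0.le, hA]; ring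

end RobinInverse

/-! ### Global approximation on the boundary -/

namespace RobinInverse

open Metric Filter Topology
open scoped NNReal

variable {n : ℕ} {Ω : Set (EuclideanSpace ℝ (Fin n))}

/-- On the boundary, the mollified gradient of an `H²` extension of `u` converges to the gradient
of `u` in `L²`, at a rate `α^{1/2}` for small `α`. -/
theorem exists_small_approx (hΩ : IsBoundedSmoothDomain Ω) {ε : ℝ} (hε : 0 < ε)
    {u F : EuclideanSpace ℝ (Fin n) → ℝ} (hu : ContDiffOn ℝ 2 u (closure Ω))
    (hF : MemH2 univ F) (hFu : F =ᵐ[volume.restrict (interior (boundaryLayer Ω ε))] u)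
    {ρ : ℝ → ℝ} (hρ : IsMollifierProfile n ρ) (i : Fin n) :
    ∃ (A : ℝ≥0) (α₁ : ℝ), 0 < α₁ ∧ α₁ ≤ 1 ∧ ∀ α, 0 < α → α ≤ α₁ →
      ∫⁻ x, ‖convKernel ρ α (weakPartial univ i F) x -
        fderivWithin ℝ u (closure Ω) x (stdVec i)‖ₑ ^ 2 ∂(surfaceMeasure Ω) ≤
          A * ENNReal.ofReal α := by
  refine hΩ.isCompact_frontier.induction_on
    (p := fun s => ∃ (A : ℝ≥0) (α₁ : ℝ), 0 < α₁ ∧ α₁ ≤ 1 ∧ ∀ α, 0 < α → α ≤ α₁ →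
      ∫⁻ x in s, ‖convKernel ρ α (weakPartial univ i F) x -
        fderivWithin ℝ u (closure Ω) x (stdVec i)‖ₑ ^ 2
          ∂(Measure.euclideanHausdorffMeasure (n - 1)) ≤ A * ENNReal.ofReal α) ?_ ?_ ?_ ?_
  · exact ⟨0, 1, one_pos, le_rfl, fun α _ _ => by simp⟩
  · rintro s t hst ⟨A, α₁, h1, h2, h3⟩
    exact ⟨A, α₁, h1, h2, fun α hα hα₁ => (lintegral_mono_set hst).trans (h3 α hα hα₁)⟩
  · rintro s t ⟨A, α₁, h1, h2, h3⟩ ⟨A', α₁', h1', h2', h3'⟩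
    refine ⟨A + A', min α₁ α₁', lt_min h1 h1', (min_le_left _ _).trans h2, fun α hα hα₁ => ?_⟩
    refine (lintegral_union_le _ _ _).trans ?_
    rw [ENNReal.coe_add, add_mul]
    exact add_le_add (h3 α hα (hα₁.trans (min_le_left _ _)))
      (h3' α hα (hα₁.trans (min_le_right _ _)))
  · intro x hx
    obtain ⟨r, hr, h⟩ := exists_local_approx hΩ hε hu hF hFu hρ i hx
    exact ⟨_, inter_mem_nhdsWithin _ (ball_mem_nhds x hr), h⟩

/-- Approximation property of the mollified gradient on the boundary, for all `α`. -/
theorem exists_approx (hΩ : IsBoundedSmoothDomain Ω) {ε : ℝ} (hε : 0 < ε)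
    {u F : EuclideanSpace ℝ (Fin n) → ℝ} (hu : ContDiffOn ℝ 2 u (closure Ω))
    (hF : MemH2 univ F) (hFu : F =ᵐ[volume.restrict (interior (boundaryLayer Ω ε))] u)
    {ρ : ℝ → ℝ} (hρ : IsMollifierProfile n ρ) {lam : ℝ} (hlam : 0 ≤ lam) (hlam' : lam ≤ 1 / 2)
    (i : Fin n) :
    ∃ A : ℝ≥0, ∀ α, 0 < α →
      ∫⁻ x, ‖convKernel ρ α (weakPartial univ i F) x -
        fderivWithin ℝ u (closure Ω) x (stdVec i)‖ₑ ^ 2 ∂(surfaceMeasure Ω) ≤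
          A * ENNReal.ofReal (α ^ lam) ^ 2 := by
  obtain ⟨A, α₁, hα₁, hα₁1, hA⟩ := exists_small_approx hΩ hε hu hF hFu hρ i
  obtain ⟨B, hB0, hB⟩ := hρ.exists_bound
  obtain ⟨K, hK⟩ := hΩ.exists_fderivWithin_bound (hu.of_le (by norm_num : (1 : WithTop ℕ∞) ≤ 2))
  set N := eLpNorm (weakPartial univ i F) 2 volume with hN
  have hNt : N < ⊤ := (hF.1.memLp_weakPartial i).2
  have hμ : surfaceMeasure Ω univ < ⊤ := surfaceMeasure_lt_top hΩ
  have hpow : ∀ α : ℝ, 0 < α → ENNReal.ofReal (α ^ lam) ^ 2 = ENNReal.ofReal (α ^ (2 * lam)) := by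
    intro α hα
    rw [← ENNReal.ofReal_pow (by positivity), ← Real.rpow_natCast, ← Real.rpow_mul hα.le]
    congr 2; push_cast; ring
  -- A bound valid for all `α ≥ α₁`, from the kernel bound at `α₁` and the bounded gradient of `u`.
  -- Dividing it by `α₁ ^ (2 * lam)` in `A'` lets the increasing power of `α` absorb it.
  set D : ℝ≥0∞ := (2 * (ENNReal.ofReal (B / α₁ ^ n) * N ^ 2) + 2 * ENNReal.ofReal (K ^ 2)) *
    surfaceMeasure Ω univ with hD
  set A' : ℝ≥0∞ := A + D * (ENNReal.ofReal (α₁ ^ (2 * lam)))⁻¹ with hA'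
  have hpos₁ : ENNReal.ofReal (α₁ ^ (2 * lam)) ≠ 0 := by
    rw [Ne, ENNReal.ofReal_eq_zero, not_le]; positivity
  have hA't : A' ≠ ⊤ := by
    simp only [hA', hD]
    finiteness
  refine ⟨A'.toNNReal, fun α hα => ?_⟩
  rw [ENNReal.coe_toNNReal hA't, hpow α hα]
  rcases le_total α α₁ with hle | hge
  · refine (hA α hα hle).trans ?_
    gcongr
    · exact le_self_add
    · calc α = α ^ (1 : ℝ) := (Real.rpow_one α).symm
        -- Here `α ≤ 1` and `2 * lam ≤ 1` weaken the rate `α^{1/2}` to `α ^ lam`.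
        _ ≤ α ^ (2 * lam) := Real.rpow_le_rpow_of_exponent_ge hα (hle.trans hα₁1) (by linarith)
  · have h1 : ∫⁻ x, ‖convKernel ρ α (weakPartial univ i F) x -
        fderivWithin ℝ u (closure Ω) x (stdVec i)‖ₑ ^ 2 ∂(surfaceMeasure Ω) ≤ D := by
      rw [hD, ← lintegral_const]
      rw [surfaceMeasure]
      refine setLIntegral_mono' isClosed_frontier.measurableSet fun x hx => ?_
      rw [sub_eq_add_neg]
      refine (enorm_add_sq_le _ _).trans ?_
      gcongr
      · refine (enorm_convKernel_sq_le_eLpNorm hρ hB hα (hF.1.memLp_weakPartial i).1 x).trans ?_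
        gcongr
      · rw [enorm_neg, ← ofReal_norm, ← ENNReal.ofReal_pow (norm_nonneg _)]
        refine ENNReal.ofReal_le_ofReal ?_
        gcongr
        refine (ContinuousLinearMap.le_opNorm _ _).trans ?_
        simpa using hK x (frontier_subset_closure hx)
    calc _ ≤ D := h1
      _ = D * (ENNReal.ofReal (α₁ ^ (2 * lam)))⁻¹ * ENNReal.ofReal (α₁ ^ (2 * lam)) := by
        rw [mul_assoc, ENNReal.inv_mul_cancel hpos₁ ENNReal.ofReal_ne_top, mul_one]
      _ ≤ A' * ENNReal.ofReal (α ^ (2 * lam)) := by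
        gcongr
        exact le_add_self

end RobinInverse

/-! ### Noise splitting and parameter choice -/

namespace RobinInverse

open Metric Filter Topology
open scoped NNReal

variable {n : ℕ}

/-- Cauchy–Schwarz in coordinates. It reduces the normal derivative to partial derivatives, so no
regularity of `ν` enters. -/
theorem enorm_apply_sq_le_sum (L : EuclideanSpace ℝ (Fin n) →L[ℝ] ℝ)
    {v : EuclideanSpace ℝ (Fin n)} (hv : ‖v‖ = 1) :
    ‖L v‖ₑ ^ 2 ≤ ∑ i, ‖L (stdVec i)‖ₑ ^ 2 := by
  simp_rw [enorm_sq_eq_ofReal]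
  rw [← ENNReal.ofReal_sum_of_nonneg fun i _ => sq_nonneg _]
  refine ENNReal.ofReal_le_ofReal ?_
  have h1 : v = ∑ i, v i • stdVec i := by
    ext j
    simp [Finset.sum_apply, Pi.single_apply]
  have h2 : L v = ∑ i, v i * L (stdVec i) := by
    conv_lhs => rw [h1]
    simp
  have h3 : ∑ i, v i ^ 2 = 1 := by
    rw [← EuclideanSpace.real_norm_sq_eq, hv, one_pow]
  calc L v ^ 2 ≤ (∑ i, v i ^ 2) * ∑ i, L (stdVec i) ^ 2 := by
        rw [h2]; exact Finset.sum_mul_sq_le_sq_mul_sq _ _ _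
    _ = _ := by rw [h3, one_mul]

section Noise

variable {W V : Set (EuclideanSpace ℝ (Fin n))} (E : SobolevExtension W V)
  {u w : EuclideanSpace ℝ (Fin n) → ℝ} {ρ : ℝ → ℝ} {α : ℝ}

/-- The partial derivatives of the mollified noisy data split into those of the noise and those of
the exact data. -/
theorem fderiv_mollify_apply (hW : IsOpen W) (hu : MemH1 W u) (hw : MemH1 W w)
    (hE : ∀ f, MemH1 W f → MemH1 univ (E.toFun f)) (hρ : IsMollifierProfile n ρ) (hα : 0 < α)
    (i : Fin n) (x : EuclideanSpace ℝ (Fin n)) :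
    fderiv ℝ (mollify ρ E α w) x (stdVec i) =
      convKernel ρ α (weakPartial univ i (E.toFun fun x => w x - u x)) x +
        convKernel ρ α (weakPartial univ i (E.toFun u)) x := by
  have hd : MemH1 W fun x => w x - u x := hw.sub hW hu
  -- Additivity is applied to `w = (w - u) + u`, since the extension acts on functions known to be
  -- in `H¹(W)` and the noise bound concerns `w - u`.
  have hsplit : E.toFun w =ᵐ[volume] fun x => E.toFun (fun x => w x - u x) x + E.toFun u x := by
    simpa using E.map_add _ _ hd hu
  have h1 : convKernel ρ α (E.toFun fun x => w x - u x) =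
      fun x => convKernel ρ α (E.toFun w) x - convKernel ρ α (E.toFun u) x := by
    rw [← convKernel_sub hρ hα (hE _ hw).locallyIntegrable (hE _ hu).locallyIntegrable]
    apply convKernel_congr_ae
    filter_upwards [hsplit] with y hy
    rw [hy]; ring
  have hdw := (contDiff_convKernel hρ hα (hE _ hw).locallyIntegrable).differentiable (by simp) x
  have hdu := (contDiff_convKernel hρ hα (hE _ hu).locallyIntegrable).differentiable (by simp) x
  rw [← fderiv_convKernel_apply hρ hα ((hE _ hd).hasWeakPartial i),
    ← fderiv_convKernel_apply hρ hα ((hE _ hu).hasWeakPartial i), h1, fderiv_fun_sub hdw hdu]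
  change fderiv ℝ (convKernel ρ α (E.toFun w)) x (stdVec i) = _
  simp

end Noise

/-- With `τ = δ^{1/(n/2+λ)}` one has `δ² = τⁿ τ^{2λ}`, so for `α` comparable to `τ` both the noise
`α^{-n/2} δ` and the approximation error `α^λ` are of order `τ^λ`. The noise bound is stated
squared. -/
theorem rpow_parameter_bounds {lam c₁ c₂ δ α B : ℝ} (hn : 0 < n) (hlam : 0 ≤ lam) (hc₁ : 0 < c₁)
    (hδ : 0 < δ) (hB : 0 ≤ B)
    (h₁ : c₁ * δ ^ (1 / ((n : ℝ) / 2 + lam)) ≤ α) (h₂ : α ≤ c₂ * δ ^ (1 / ((n : ℝ) / 2 + lam))) :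
    B / α ^ n * δ ^ 2 ≤ B / c₁ ^ n * (δ ^ (lam / ((n : ℝ) / 2 + lam))) ^ 2 ∧
      α ^ lam ≤ c₂ ^ lam * δ ^ (lam / ((n : ℝ) / 2 + lam)) := by
  have hn' : (0 : ℝ) < n := by exact_mod_cast hn
  set p := (n : ℝ) / 2 + lam with hp
  have hp0 : 0 < p := by positivity
  set τ := δ ^ (1 / p) with hτ
  have hτ0 : 0 < τ := by positivity
  have hδτ : δ = τ ^ p := by rw [hτ, ← Real.rpow_mul hδ.le]; field_simp; simp
  have hT : δ ^ (lam / p) = τ ^ lam := by rw [hτ, ← Real.rpow_mul hδ.le]; congr 1; ring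
  have hα : 0 < α := lt_of_lt_of_le (by positivity) h₁
  have hc₂ : 0 ≤ c₂ := by
    by_contra! hneg
    nlinarith
  rw [hT]
  constructor
  · have h3 : δ ^ 2 = τ ^ n * (τ ^ lam) ^ 2 := by
      rw [hδτ, ← Real.rpow_natCast, ← Real.rpow_natCast, ← Real.rpow_natCast, ← Real.rpow_mul hτ0.le,
        ← Real.rpow_mul hτ0.le, ← Real.rpow_add hτ0]
      congr 1
      rw [hp]; push_cast; ring
    have h4 : c₁ ^ n * τ ^ n ≤ α ^ n := by rw [← mul_pow]; gcongr
    rw [h3]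
    calc B / α ^ n * (τ ^ n * (τ ^ lam) ^ 2) ≤
          B / (c₁ ^ n * τ ^ n) * (τ ^ n * (τ ^ lam) ^ 2) := by gcongr
      _ = B / c₁ ^ n * (τ ^ lam) ^ 2 := by field_simp
  · rw [← Real.mul_rpow hc₂ hτ0.le]
    gcongr

end RobinInverse

/-! ### The convergence rate -/

theorem mainTheorem6 {n : ℕ} (hn : n = 2 ∨ n = 3)
    (Ω : Set (EuclideanSpace ℝ (Fin n))) (hΩ : RobinInverse.IsBoundedSmoothDomain Ω)
    (ν : EuclideanSpace ℝ (Fin n) → EuclideanSpace ℝ (Fin n))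
    (hν : ∀ x ∈ frontier Ω, RobinInverse.IsOutwardUnitNormal Ω x (ν x))
    (ε : ℝ) (hε : 0 < ε)
    (σ h g u : EuclideanSpace ℝ (Fin n) → ℝ)
    (hσ : ContDiffOn ℝ 1 σ (closure Ω)) (hσ_pos : ∀ x ∈ closure Ω, 0 < σ x)
    (hh : ContinuousOn h (frontier Ω)) (hh_pos : ∀ x ∈ frontier Ω, 0 < h x)
    (hg : ContinuousOn g (frontier Ω)) (hg_nonpos : ∀ x ∈ frontier Ω, g x ≤ 0)
    (hg_ne : ∃ x ∈ frontier Ω, g x ≠ 0)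
    (α₀ : ℝ) (hα₀ : 0 < α₀) (hα₀' : α₀ < 1)
    (hu : RobinInverse.MemC2Holder Ω α₀ u)
    (hsol : RobinInverse.IsRobinSolution Ω ν σ h g u)
    (ρ : ℝ → ℝ) (hρ : RobinInverse.IsMollifierProfile n ρ)
    (V : Set (EuclideanSpace ℝ (Fin n)))
    (E : RobinInverse.SobolevExtension (interior (RobinInverse.boundaryLayer Ω ε)) V)
    (lam : ℝ) (hlam : lam = min α₀ (1 / 2))
    (c₁ c₂ : ℝ) (hc₁ : 0 < c₁) (hc₂ : c₁ ≤ c₂) :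
    ∃ C : ℝ, 0 < C ∧ ∀ δ : ℝ, 0 < δ →
      ∀ α : ℝ, c₁ * δ ^ (1 / ((n : ℝ) / 2 + lam)) ≤ α → α ≤ c₂ * δ ^ (1 / ((n : ℝ) / 2 + lam)) →
      ∀ Uδ : EuclideanSpace ℝ (Fin n) → ℝ,
        RobinInverse.MemH1 (interior (RobinInverse.boundaryLayer Ω ε)) Uδ →
        RobinInverse.h1Norm (interior (RobinInverse.boundaryLayer Ω ε)) (fun x => Uδ x - u x)
          ≤ ENNReal.ofReal δ →
        MeasureTheory.eLpNorm
            (fun x => RobinInverse.regularizedRobin ρ E ν σ g u α Uδ x - h x) 2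
            (RobinInverse.surfaceMeasure Ω)
          ≤ ENNReal.ofReal (C * δ ^ (lam / ((n : ℝ) / 2 + lam))) := by
  have hn0 : 0 < n := by rcases hn with rfl | rfl <;> norm_num
  have hlam0 : 0 ≤ lam := by rw [hlam]; positivity
  have hlam1 : lam ≤ 1 / 2 := by rw [hlam]; exact min_le_right _ _
  have huC := hu.1
  have hneg := hsol.neg_on_frontier hΩ hν hσ hσ_pos hh_pos hg_nonpos hg_ne huC
  obtain ⟨Q, hQ⟩ := hΩ.isCompact_frontier.exists_bound_of_continuousOn
    (f := fun x => σ x / u x) ((hσ.continuousOn.mono frontier_subset_closure).div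
      (huC.continuousOn.mono frontier_subset_closure) fun x hx => (hneg x hx).ne)
  have hWo : IsOpen (interior (RobinInverse.boundaryLayer Ω ε)) := isOpen_interior
  have hWΩ : interior (RobinInverse.boundaryLayer Ω ε) ⊆ Ω := interior_subset.trans fun x hx => hx.1
  have huH2 : RobinInverse.MemH2 (interior (RobinInverse.boundaryLayer Ω ε)) u :=
    RobinInverse.memH2_of_contDiffOn_closure hΩ hWo hWΩ huC
  obtain ⟨CE, hCE⟩ := E.bound_h1
  have hF := E.map_h2 u huH2
  have hFu := E.extends_fun u huH2.1
  choose A hA using RobinInverse.exists_approx hΩ hε huC hF hFu hρ hlam0 hlam1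
  obtain ⟨B, hB0, hB⟩ := hρ.exists_bound
  have hμ : RobinInverse.surfaceMeasure Ω univ < ⊤ := RobinInverse.surfaceMeasure_lt_top hΩ
  -- The squared constant: `Q` bounds `σ / u` on `∂Ω`, and each coordinate contributes a noise term
  -- and an approximation term, doubled by `(a + b)² ≤ 2a² + 2b²`.
  set Z : ENNReal := ENNReal.ofReal (Q ^ 2) * ∑ i : Fin n,
    (2 * (ENNReal.ofReal (B / c₁ ^ n) * ENNReal.ofReal CE ^ 2 *
      RobinInverse.surfaceMeasure Ω univ) + 2 * (A i * ENNReal.ofReal (c₂ ^ lam) ^ 2)) with hZ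
  have hZt : Z ≠ ⊤ := by
    refine ENNReal.mul_ne_top ENNReal.ofReal_ne_top (ENNReal.sum_ne_top.2 fun i _ => ?_)
    finiteness
  -- Adding one keeps the constant positive even if `Z` vanishes.
  refine ⟨Real.sqrt Z.toReal + 1, by positivity, fun δ hδ α hα₁ hα₂ Uδ hUδ hnoise => ?_⟩
  have hα : 0 < α := lt_of_lt_of_le (by positivity) hα₁
  obtain ⟨hpar₁, hpar₂⟩ := RobinInverse.rpow_parameter_bounds hn0 hlam0 hc₁ hδ hB0 hα₁ hα₂
  set T := δ ^ (lam / ((n : ℝ) / 2 + lam)) with hT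
  have hT0 : 0 < T := by positivity
  set Fd := E.toFun fun x => Uδ x - u x with hFd
  have hd : RobinInverse.MemH1 (interior (RobinInverse.boundaryLayer Ω ε))
      fun x => Uδ x - u x := hUδ.sub hWo huH2.1
  have hFd1 : RobinInverse.MemH1 univ Fd := (hCE _ hd).1
  set noise : Fin n → EuclideanSpace ℝ (Fin n) → ℝ := fun i =>
    RobinInverse.convKernel ρ α (RobinInverse.weakPartial univ i Fd) with hnoise_def
  set err : Fin n → EuclideanSpace ℝ (Fin n) → ℝ := fun i x =>
    RobinInverse.convKernel ρ α (RobinInverse.weakPartial univ i (E.toFun u)) x -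
      fderivWithin ℝ u (closure Ω) x (RobinInverse.stdVec i) with herr
  have hnoise_le : ∀ i x, ‖noise i x‖ₑ ^ 2 ≤
      ENNReal.ofReal (B / c₁ ^ n) * ENNReal.ofReal CE ^ 2 * ENNReal.ofReal T ^ 2 := by
    intro i x
    refine (RobinInverse.enorm_convKernel_sq_le_eLpNorm hρ hB hα
      (hFd1.memLp_weakPartial i).1 x).trans ?_
    have h1 : eLpNorm (RobinInverse.weakPartial univ i Fd) 2 volume ≤
        ENNReal.ofReal CE * ENNReal.ofReal δ := by
      have h2 := RobinInverse.eLpNorm_weakPartial_le_h1Norm (W := univ) Fd i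
      rw [Measure.restrict_univ] at h2
      exact h2.trans ((hCE _ hd).2.trans (by gcongr))
    calc _ ≤ ENNReal.ofReal (B / α ^ n) * (ENNReal.ofReal CE * ENNReal.ofReal δ) ^ 2 := by gcongr
      _ = ENNReal.ofReal CE ^ 2 * ENNReal.ofReal (B / α ^ n * δ ^ 2) := by
        rw [ENNReal.ofReal_mul (by positivity), ENNReal.ofReal_pow hδ.le]; ring
      _ ≤ ENNReal.ofReal CE ^ 2 * ENNReal.ofReal (B / c₁ ^ n * T ^ 2) := by gcongr
      _ = _ := by
        rw [ENNReal.ofReal_mul (by positivity), ENNReal.ofReal_pow hT0.le]; ring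
  have herr_le : ∀ i, ∫⁻ x, ‖err i x‖ₑ ^ 2 ∂(RobinInverse.surfaceMeasure Ω) ≤
      A i * ENNReal.ofReal (c₂ ^ lam) ^ 2 * ENNReal.ofReal T ^ 2 := by
    intro i
    refine (hA i α hα).trans ?_
    have hc₂0 : 0 ≤ c₂ := hc₁.le.trans hc₂
    calc _ ≤ A i * ENNReal.ofReal (c₂ ^ lam * T) ^ 2 := by gcongr
      _ = _ := by rw [ENNReal.ofReal_mul (by positivity)]; ring
  have hmeas : ∀ i, AEMeasurable (fun x => 2 * ‖noise i x‖ₑ ^ 2 + 2 * ‖err i x‖ₑ ^ 2)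
      (RobinInverse.surfaceMeasure Ω) := by
    intro i
    have h1 : Continuous (noise i) := (RobinInverse.contDiff_convKernel hρ hα
      ((hFd1.memLp_weakPartial i).locallyIntegrable (by norm_num))).continuous
    have h2 : ContinuousOn (err i) (frontier Ω) := by
      have h3 := (RobinInverse.contDiff_convKernel hρ hα
        ((hF.1.memLp_weakPartial i).locallyIntegrable (by norm_num))).continuous
      have h4 := (huC.continuousOn_fderivWithin hΩ.uniqueDiffOn_closure (by simp)).mono
        frontier_subset_closure
      exact h3.continuousOn.sub (h4.clm_apply continuousOn_const)
    have h5 : AEMeasurable (err i) (RobinInverse.surfaceMeasure Ω) :=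
      h2.aemeasurable isClosed_frontier.measurableSet
    exact ((h1.enorm.measurable.pow_const 2).const_mul 2).aemeasurable.add
      ((h5.enorm.pow_const 2).const_mul 2)
  have hpt : ∀ x ∈ frontier Ω,
      ‖RobinInverse.regularizedRobin ρ E ν σ g u α Uδ x - h x‖ₑ ^ 2 ≤
        ENNReal.ofReal (Q ^ 2) * ∑ i, (2 * ‖noise i x‖ₑ ^ 2 + 2 * ‖err i x‖ₑ ^ 2) := by
    intro x hx
    set L := fderiv ℝ (RobinInverse.mollify ρ E α Uδ) x - fderivWithin ℝ u (closure Ω) x with hL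
    have hux := (hneg x hx).ne
    -- Eliminating `g` through the boundary condition cancels `h`, because `u x ≠ 0`, and leaves
    -- only the error of the normal derivative.
    have h1 : RobinInverse.regularizedRobin ρ E ν σ g u α Uδ x - h x =
        -(σ x / u x) * L (ν x) := by
      have hb := hsol.boundary x hx
      rw [RobinInverse.regularizedRobin, ← hb, hL, sub_apply]
      field_simp
      ring
    rw [h1, enorm_mul, mul_pow]
    gcongr
    · rw [enorm_neg, ← ofReal_norm, ← ENNReal.ofReal_pow (norm_nonneg _)]
      refine ENNReal.ofReal_le_ofReal ?_
      gcongr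
      exact hQ x hx
    · refine (RobinInverse.enorm_apply_sq_le_sum L (hν x hx).norm_eq_one).trans ?_
      refine Finset.sum_le_sum fun i _ => ?_
      refine le_trans (le_of_eq ?_) (RobinInverse.enorm_add_sq_le _ _)
      rw [hL, sub_apply, RobinInverse.fderiv_mollify_apply E hWo huH2.1 hUδ
        (fun f hf => (hCE f hf).1) hρ hα, add_sub_assoc]
  have hsq : eLpNorm (fun x => RobinInverse.regularizedRobin ρ E ν σ g u α Uδ x - h x) 2
      (RobinInverse.surfaceMeasure Ω) ^ 2 ≤ Z * ENNReal.ofReal T ^ 2 := by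
    rw [RobinInverse.eLpNorm_two_sq]
    calc _ ≤ ∫⁻ x, ENNReal.ofReal (Q ^ 2) *
          ∑ i, (2 * ‖noise i x‖ₑ ^ 2 + 2 * ‖err i x‖ₑ ^ 2) ∂(RobinInverse.surfaceMeasure Ω) :=
          setLIntegral_mono' isClosed_frontier.measurableSet hpt
      _ = ENNReal.ofReal (Q ^ 2) * ∑ i, ∫⁻ x, (2 * ‖noise i x‖ₑ ^ 2 + 2 * ‖err i x‖ₑ ^ 2)
          ∂(RobinInverse.surfaceMeasure Ω) := by
          rw [lintegral_const_mul' _ _ ENNReal.ofReal_ne_top,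
            lintegral_finsetSum' _ fun i _ => hmeas i]
      _ ≤ ENNReal.ofReal (Q ^ 2) * ∑ i, (2 * (ENNReal.ofReal (B / c₁ ^ n) *
            ENNReal.ofReal CE ^ 2 * RobinInverse.surfaceMeasure Ω univ) +
            2 * (A i * ENNReal.ofReal (c₂ ^ lam) ^ 2)) * ENNReal.ofReal T ^ 2 := by
          gcongr with i
          calc _ ≤ ∫⁻ x, (2 * (ENNReal.ofReal (B / c₁ ^ n) * ENNReal.ofReal CE ^ 2 *
                ENNReal.ofReal T ^ 2) + 2 * ‖err i x‖ₑ ^ 2)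
                ∂(RobinInverse.surfaceMeasure Ω) := by
                gcongr with x
                exact hnoise_le i x
            _ = 2 * (ENNReal.ofReal (B / c₁ ^ n) * ENNReal.ofReal CE ^ 2 *
                ENNReal.ofReal T ^ 2) * RobinInverse.surfaceMeasure Ω univ +
                2 * ∫⁻ x, ‖err i x‖ₑ ^ 2 ∂(RobinInverse.surfaceMeasure Ω) := by
                rw [lintegral_add_left measurable_const, lintegral_const,
                  lintegral_const_mul' _ _ (by simp)]
            _ ≤ 2 * (ENNReal.ofReal (B / c₁ ^ n) * ENNReal.ofReal CE ^ 2 *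
                ENNReal.ofReal T ^ 2) * RobinInverse.surfaceMeasure Ω univ +
                2 * (A i * ENNReal.ofReal (c₂ ^ lam) ^ 2 * ENNReal.ofReal T ^ 2) := by
                gcongr
                exact herr_le i
            _ = _ := by ring
      _ = Z * ENNReal.ofReal T ^ 2 := by rw [hZ, ← Finset.sum_mul]; exact (mul_assoc _ _ _).symm
  refine (ENNReal.pow_le_pow_left_iff two_ne_zero).1 (hsq.trans ?_)
  rw [ENNReal.ofReal_mul (by positivity), mul_pow]
  gcongr
  rw [← ENNReal.ofReal_pow (by positivity)]
  refine ENNReal.le_ofReal_iff_toReal_le hZt (by positivity) |>.2 ?_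
  nlinarith [Real.sq_sqrt (ENNReal.toReal_nonneg (a := Z)), Real.sqrt_nonneg Z.toReal]
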